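/- Let $n\ge m$ be natural numbers, and for $p>0$ and a real matrix $M\in\mathbb{R}^{n\times m}$ with singular values $\sigma_1\ge\cdots\ge\sigma_m\ge0$ put $\|M\|_p=\big(\sum_{i=1}^m\sigma_i^p\big)^{1/p}$ (the Schatten norm, a quasi-norm for $p<1$). For $\alpha\ge0$ let $\pi_{p,\alpha}(M)=\|M\|_p^{-\alpha}\in(0,\infty]$, with $\pi_{p,\alpha}(0)=\infty$ if $\alpha>0$ and $\pi_{p,0}\equiv1$. Identify $\mathbb{R}^{n\times m}$ with Euclidean space through the matrix entries (Frobenius norm). Suppose that either - $p\in[1,2]$ and $0\le\alpha\le nm-(1-p/2)m(m+1)-p$, or - $p\in(0,1)$ and $0\le\alpha\le nm-m(m+1)+(m-1)p$. Then $\pi_{p,\alpha}$ is superharmonic on $\mathbb{R}^{n\times m}$: it is not identically $\infty$, it is lower semicontinuous, and for every $M$ and every $r>0$ the mean of $\pi_{p,\alpha}$ over the Frobenius sphere with centre $M$ and radius $r$ is at most $\pi_{p,\alpha}(M)$. Moreover, $\pi_{p,\alpha}$ is finite at every matrix of rank $m$ and of class $C^2$ in a neighbourhood of it, and $$\Delta\pi_{p,\alpha}(M)=\sum_{i=1}^n\sum_{j=1}^m\frac{\partial^2\pi_{p,\alpha}}{\partial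 M_{ij}^2}(M)\le0$$ at every $M$ near which $\pi_{p,\alpha}$ is finite and of class $C^2$. -/

import Mathlib

open MeasureTheory InnerProductSpace
open scoped ENNReal

/-- The space of real `n × m` matrices with the Frobenius inner product: the coordinates of a point
are the entries `M (i, j)`. -/
abbrev MatrixSpace (n m : ℕ) : Type := EuclideanSpace ℝ (Fin n × Fin m)

/-- The point `M` as a matrix. -/
def MatrixSpace.toMatrix {n m : ℕ} (M : MatrixSpace n m) : Matrix (Fin n) (Fin m) ℝ :=
  Matrix.of fun i j => M (i, j)

/-- The `i`-th singular value of a real `n × m` matrix in decreasing order (with multiplicity,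
possibly zero), for `i = 0, …, m - 1`. -/
noncomputable def matrixSingularValue {n m : ℕ} (A : Matrix (Fin n) (Fin m) ℝ) (i : Fin m) : ℝ :=
  (Matrix.toEuclideanLin A).singularValues (i : ℕ)

/-- The Schatten (quasi-)norm `(∑ σᵢ ^ p) ^ (1 / p)`, for `p > 0`. -/
noncomputable def schattenNorm {n m : ℕ} (p : ℝ) (A : Matrix (Fin n) (Fin m) ℝ) : ℝ :=
  (∑ i : Fin m, matrixSingularValue A i ^ p) ^ (1 / p)

/-- The prior density `‖M‖_p ^ (-α)`, with values in `[0, ∞]`: for `α > 0` it is `∞` at `M = 0`,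
and for `α = 0` it is the constant `1`. -/
noncomputable def schattenPrior {n m : ℕ} (p α : ℝ) (M : MatrixSpace n m) : ℝ≥0∞ :=
  ENNReal.ofReal (schattenNorm p M.toMatrix) ^ (-α)

/-- The mean of `u` over the sphere of centre `x` and radius `r`, with respect to the normalised
surface measure. -/
noncomputable def sphereMean {E : Type*} [NormedAddCommGroup E] [InnerProductSpace ℝ E]
    [FiniteDimensional ℝ E] [MeasurableSpace E] [BorelSpace E] (u : E → ℝ≥0∞) (x : E) (r : ℝ) :
    ℝ≥0∞ :=
  ⨍⁻ ω : Metric.sphere (0 : E) 1, u (x + r • (ω : E)) ∂(volume : Measure E).toSphere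

/-- Superharmonicity, in the sense of potential theory, of a function `u : E → [0, ∞]` on a
Euclidean space: `u` is not identically `∞`, it is lower semicontinuous, and its value at each point
is at least its mean over each sphere centred there. (The condition `u > -∞` is automatic.) -/
structure IsSuperharmonic {E : Type*} [NormedAddCommGroup E] [InnerProductSpace ℝ E]
    [FiniteDimensional ℝ E] [MeasurableSpace E] [BorelSpace E] (u : E → ℝ≥0∞) : Prop where
  exists_ne_top : ∃ x, u x ≠ ∞
  lowerSemicontinuous : LowerSemicontinuous u
  sphereMean_le : ∀ (x : E) (r : ℝ), 0 < r → sphereMean u x r ≤ u x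

/-- The Laplacian `∑ᵢ ∑ⱼ ∂²f / ∂M_{ij}²` in the matrix entries. -/
noncomputable def matrixLaplacian {n m : ℕ} (f : MatrixSpace n m → ℝ) (M : MatrixSpace n m) : ℝ :=
  ∑ i : Fin n, ∑ j : Fin m,
    iteratedFDeriv ℝ 2 f M
      ![EuclideanSpace.single (i, j) (1 : ℝ), EuclideanSpace.single (i, j) (1 : ℝ)]

/-! Fix ε ≥ 0 and put μ_a = σ_a² + ε, q = p/2, G = ∑ μ_a^q. The regularised prior G^(-α/p) is
bi-orthogonally invariant, and for ε > 0 it is smooth and increases to the Schatten prior as ε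
decreases to 0. So it suffices to show that its Laplacian is nonpositive: superharmonicity follows
from the mean value inequality for smooth functions and monotone convergence, and the pointwise
claim is the case ε = 0.

An invariant function is constant along the curves obtained by rotating rows and columns of a
diagonal matrix. Differentiating twice along them expresses the off-diagonal second derivatives
through first derivatives (`matrixLaplacian_eq_of_rectDiagonal`): with ∂_a the derivative in the
singular value s_a, Δ = ∑ ∂_a² + (n - m) ∑ ∂_a / s_a + ∑_{a ≠ b} (s_a ∂_a - s_b ∂_b) / (s_a² -
s_b²). For the regularised prior, nonpositivity then follows from (α + p) ∑ μ_a^(p-1) ≤ G ((p - 1 +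
n - m) ∑ μ_a^(q-1) + ∑_{a ≠ b} (μ_a^q - μ_b^q) / (μ_a - μ_b)), which is `powerSum_inequality`.
Chebyshev's sum inequality bounds the first term on the right. For p ≥ 1 it also bounds the second,
after concavity of x^(p-1) is used through the trapezoidal rule; for p < 1 the second term is only
known to be nonnegative. These two treatments produce the two bounds on α.

The formula needs distinct positive singular values; a perturbation and continuity of the Laplacian
remove this restriction. The mean value inequality (`integral_toSphere_le_of_laplacian_nonpos`) is
derived from rotation invariance of the surface measure. -/

/-! ### Singular values, the Gram matrix and the singular value decomposition -/

open Matrix in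
/-- The Gram matrix is orthogonally diagonalised by the squared singular values. -/
lemma exists_orthogonal_gram_eq {n m : ℕ} (A : Matrix (Fin n) (Fin m) ℝ) :
    ∃ Q : Matrix (Fin m) (Fin m) ℝ, Qᵀ * Q = 1 ∧
      Aᵀ * A = Q * diagonal (fun i => matrixSingularValue A i ^ 2) * Qᵀ := by
  set T := Matrix.toEuclideanLin A with hT
  have hn : Module.finrank ℝ (EuclideanSpace ℝ (Fin m)) = m := by simp
  have hs := T.isSymmetric_adjoint_comp_self
  set b := hs.eigenvectorBasis hn with hb
  have hd : ∀ i, matrixSingularValue A i ^ 2 = hs.eigenvalues hn i := fun i =>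
    T.sq_singularValues_fin hn i
  set Q : Matrix (Fin m) (Fin m) ℝ := Matrix.of fun i j => b j i with hQ
  have hQQ : Qᵀ * Q = 1 := by
    ext i j
    have := orthonormal_iff_ite.mp b.orthonormal i j
    rw [PiLp.inner_apply] at this
    simp only [RCLike.inner_apply, conj_trivial] at this
    simp only [mul_apply, transpose_apply, hQ, of_apply, one_apply]
    rw [← this]
    exact Finset.sum_congr rfl fun k _ => mul_comm _ _
  have hQQ' : Q * Qᵀ = 1 := mul_eq_one_comm.mp hQQ
  refine ⟨Q, hQQ, ?_⟩
  have key : Aᵀ * A * Q = Q * diagonal (fun i => matrixSingularValue A i ^ 2) := by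
    ext i j
    have h := hs.apply_eigenvectorBasis hn j
    rw [← hb] at h
    rw [mul_diagonal, hd]
    generalize hs.eigenvalues hn j = ev at h ⊢
    have h2 := congrArg (fun v : EuclideanSpace ℝ (Fin m) => v i) h
    simp only [LinearMap.comp_apply, hT, ← Matrix.toEuclideanLin_conjTranspose_eq_adjoint,
      toLpLin_apply, conjTranspose_eq_transpose_of_trivial,
      mulVec_mulVec, PiLp.smul_apply] at h2
    simpa [mulVec, dotProduct, mul_apply, hQ, mul_comm] using h2
  rw [← key, Matrix.mul_assoc, hQQ', Matrix.mul_one]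

open Matrix in
/-- Symmetric functions of the squared singular values can be computed from any diagonalisation of
the Gram matrix. -/
lemma sum_singularValue_sq_eq {n m : ℕ} {A : Matrix (Fin n) (Fin m) ℝ}
    {Q : Matrix (Fin m) (Fin m) ℝ} {d : Fin m → ℝ} (hQ : Qᵀ * Q = 1)
    (h : Aᵀ * A = Q * diagonal d * Qᵀ) (g : ℝ → ℝ) :
    ∑ i, g (matrixSingularValue A i ^ 2) = ∑ i, g (d i) := by
  obtain ⟨R, hR, hRA⟩ := exists_orthogonal_gram_eq A
  -- The diagonal entries are the roots of the characteristic polynomial, so any two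
  -- diagonalisations agree as multisets.
  have aux : ∀ (Q : Matrix (Fin m) (Fin m) ℝ) (d : Fin m → ℝ), Qᵀ * Q = 1 →
      (Q * diagonal d * Qᵀ).charpoly.roots = Finset.univ.val.map d := by
    intro Q d hQ
    rw [charpoly_mul_comm, ← Matrix.mul_assoc, hQ, Matrix.one_mul, charpoly_diagonal,
      Polynomial.roots_prod _ _ (Finset.prod_ne_zero_iff.mpr fun i _ => Polynomial.X_sub_C_ne_zero _)]
    simp
  have h1 := aux R (fun i => matrixSingularValue A i ^ 2) hR
  rw [← hRA, h, aux Q d hQ] at h1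
  have h2 := congrArg (fun s => (s.map g).sum) h1
  simp only [Multiset.map_map] at h2
  exact h2.symm

open Matrix in
/-- Symmetric functions of the singular values are bi-orthogonally invariant. -/
lemma sum_singularValue_sq_mul_mul {n m : ℕ} (A : Matrix (Fin n) (Fin m) ℝ)
    {U : Matrix (Fin n) (Fin n) ℝ} {V : Matrix (Fin m) (Fin m) ℝ} (hU : Uᵀ * U = 1)
    (hV : Vᵀ * V = 1) (g : ℝ → ℝ) :
    ∑ i, g (matrixSingularValue (U * A * V) i ^ 2) = ∑ i, g (matrixSingularValue A i ^ 2) := by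
  obtain ⟨Q, hQ, hQA⟩ := exists_orthogonal_gram_eq A
  have hV' : V * Vᵀ = 1 := mul_eq_one_comm.mp hV
  refine sum_singularValue_sq_eq (Q := Vᵀ * Q) ?_ ?_ g
  · rw [transpose_mul, transpose_transpose, Matrix.mul_assoc, ← Matrix.mul_assoc V, hV',
      Matrix.one_mul, hQ]
  · calc (U * A * V)ᵀ * (U * A * V) = Vᵀ * (Aᵀ * (Uᵀ * U) * A) * V := by
          simp only [transpose_mul, Matrix.mul_assoc]
      _ = _ := by
          rw [hU, Matrix.mul_one, hQA]
          simp only [transpose_mul, transpose_transpose, Matrix.mul_assoc]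

/-- The rectangular diagonal matrix with diagonal entries `s`. -/
def rectDiagonal (n : ℕ) {m : ℕ} (s : Fin m → ℝ) : Matrix (Fin n) (Fin m) ℝ :=
  Matrix.of fun i j => if (i : ℕ) = j then s j else 0

open Matrix in
lemma rectDiagonal_gram {n m : ℕ} (hmn : m ≤ n) (s : Fin m → ℝ) :
    (rectDiagonal n s)ᵀ * rectDiagonal n s = diagonal (fun i => s i ^ 2) := by
  ext i j
  simp only [mul_apply, transpose_apply, rectDiagonal, of_apply, diagonal_apply]
  rw [Finset.sum_eq_single (Fin.castLE hmn i)]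
  · by_cases hij : i = j
    · subst hij; simp [sq]
    · have : (i : ℕ) ≠ j := fun h => hij (Fin.ext h)
      simp [hij, this]
  · intro k _ hk
    have : (k : ℕ) ≠ i := fun h => hk (Fin.ext h)
    simp [this]
  · simp

lemma sum_singularValue_sq_rectDiagonal {n m : ℕ} (hmn : m ≤ n) (s : Fin m → ℝ) (g : ℝ → ℝ) :
    ∑ i, g (matrixSingularValue (rectDiagonal n s) i ^ 2) = ∑ i, g (s i ^ 2) :=
  sum_singularValue_sq_eq (Q := 1) (by simp) (by simp [rectDiagonal_gram hmn]) g

open Matrix in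
/-- The singular value decomposition. -/
lemma exists_singularValue_decomposition {n m : ℕ} (hmn : m ≤ n) (A : Matrix (Fin n) (Fin m) ℝ) :
    ∃ (U : Matrix (Fin n) (Fin n) ℝ) (V : Matrix (Fin m) (Fin m) ℝ), Uᵀ * U = 1 ∧ Vᵀ * V = 1 ∧
      A = U * rectDiagonal n (matrixSingularValue A) * V := by
  obtain ⟨Q, hQ, hQA⟩ := exists_orthogonal_gram_eq A
  set σ := matrixSingularValue A with hσ
  have hQ' : Q * Qᵀ = 1 := mul_eq_one_comm.mp hQ
  have hB : (A * Q)ᵀ * (A * Q) = diagonal (fun i => σ i ^ 2) := by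
    calc (A * Q)ᵀ * (A * Q) = Qᵀ * (Aᵀ * A) * Q := by
          simp only [transpose_mul, Matrix.mul_assoc]
      _ = (Qᵀ * Q) * diagonal (fun i => σ i ^ 2) * (Qᵀ * Q) := by
          rw [hQA]; simp only [Matrix.mul_assoc]
      _ = _ := by rw [hQ]; simp
  -- the normalised columns of `A * Q`, indexed by the rows
  let v : Fin n → EuclideanSpace ℝ (Fin n) := fun i =>
    if h : (i : ℕ) < m then WithLp.toLp 2 fun k => (σ ⟨i, h⟩)⁻¹ * (A * Q) k ⟨i, h⟩ else 0
  -- Only the columns with nonzero singular value are orthonormal after normalisation; the others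
  -- are supplied by extension to an orthonormal basis.
  let S : Set (Fin n) := {i | ∃ h : (i : ℕ) < m, σ ⟨i, h⟩ ≠ 0}
  have hvS : ∀ (i : Fin n) (h : (i : ℕ) < m) (k : Fin n),
      v i k = (σ ⟨i, h⟩)⁻¹ * (A * Q) k ⟨i, h⟩ := by
    intro i h k
    simp [v, h]
  have hv : Orthonormal ℝ (S.domRestrict v) := by
    rw [orthonormal_iff_ite]
    rintro ⟨i, hi, hi'⟩ ⟨j, hj, hj'⟩
    have e := congrFun (congrFun hB ⟨i, hi⟩) ⟨j, hj⟩
    have hin : inner ℝ (v i) (v j) = ∑ k, v j k * v i k := by simp [PiLp.inner_apply]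
    have : ∀ k, v j k * v i k =
        (σ ⟨j, hj⟩)⁻¹ * (σ ⟨i, hi⟩)⁻¹ * ((A * Q)ᵀ ⟨i, hi⟩ k * (A * Q) k ⟨j, hj⟩) := by
      intro k
      rw [hvS _ hi, hvS _ hj, transpose_apply]
      ring
    rw [Set.domRestrict_apply, Set.domRestrict_apply, hin, Finset.sum_congr rfl fun k _ => this k]
    rw [← Finset.mul_sum, ← Matrix.mul_apply, e, diagonal_apply]
    by_cases hij : i = j
    · subst hij
      simp only [if_true]
      field_simp
    · have h1 : (⟨i, hi⟩ : Fin m) ≠ ⟨j, hj⟩ := by simpa [Fin.ext_iff] using hij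
      have h2 : (⟨i, ⟨hi, hi'⟩⟩ : S) ≠ ⟨j, ⟨hj, hj'⟩⟩ := by simpa using hij
      rw [if_neg h1, if_neg h2, mul_zero]
  obtain ⟨b, hb⟩ := hv.exists_orthonormalBasis_extension_of_card_eq (by simp)
  set U : Matrix (Fin n) (Fin n) ℝ := Matrix.of fun i j => b j i with hU
  have hUU : Uᵀ * U = 1 := by
    ext i j
    have := orthonormal_iff_ite.mp b.orthonormal i j
    rw [PiLp.inner_apply] at this
    simp only [RCLike.inner_apply, conj_trivial] at this
    simp only [mul_apply, transpose_apply, hU, of_apply, one_apply]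
    rw [← this]
    exact Finset.sum_congr rfl fun k _ => mul_comm _ _
  refine ⟨U, Qᵀ, hUU, by simpa using hQ', ?_⟩
  have hAQ : A * Q = U * rectDiagonal n σ := by
    ext k j
    have hj : (j : ℕ) < n := lt_of_lt_of_le j.2 hmn
    have hrhs : (U * rectDiagonal n σ) k j = U k (Fin.castLE hmn j) * σ j := by
      rw [mul_apply, Finset.sum_eq_single (Fin.castLE hmn j)]
      · simp [rectDiagonal]
      · intro i _ hi
        have : (i : ℕ) ≠ j := fun h => hi (Fin.ext h)
        simp [rectDiagonal, this]
      · simp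
    rw [hrhs]
    -- If the singular value vanishes, the column of `A * Q` has norm zero, so the choice of basis
    -- vector is immaterial.
    by_cases h0 : σ j = 0
    · have e := congrFun (congrFun hB j) j
      rw [mul_apply, diagonal_apply_eq, h0] at e
      simp only [transpose_apply] at e
      have := (Finset.sum_eq_zero_iff_of_nonneg (fun i _ => mul_self_nonneg ((A * Q) i j))).mp
        (by simpa using e) k (Finset.mem_univ _)
      rw [mul_self_eq_zero.mp this, h0, mul_zero]
    · have := hb (Fin.castLE hmn j) ⟨by simp, by simpa using h0⟩
      have hlt : ((Fin.castLE hmn j : Fin n) : ℕ) < m := by simp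
      simp only [hU, of_apply, this, hvS _ hlt, Fin.val_castLE, Fin.eta]
      field_simp
  rw [← hAQ, Matrix.mul_assoc, hQ', Matrix.mul_one]

/-! ### Smoothness of spectral power sums through the binomial series -/

/-- The sum `∑ (σᵢ² + ε) ^ q` over the singular values. -/
noncomputable def spectralPowerSum {n m : ℕ} (ε q : ℝ) (A : Matrix (Fin n) (Fin m) ℝ) : ℝ :=
  ∑ i : Fin m, (matrixSingularValue A i ^ 2 + ε) ^ q

section

open scoped Matrix.Norms.L2Operator

/-- In positive degree the coefficients are bounded in norm by those of the scalar series, which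
converges on the unit ball. -/
lemma one_le_radius_binomialSeries_matrix (m : ℕ) (q : ℝ) :
    1 ≤ (binomialSeries (Matrix (Fin m) (Fin m) ℝ) q).radius := by
  refine ENNReal.le_of_forall_nnreal_lt fun r hr => ?_
  have h1 : (r : ℝ≥0∞) < (binomialSeries ℝ q).radius :=
    hr.trans_le (Real.one_add_rpow_hasFPowerSeriesOnBall_zero (a := q)).r_le
  obtain ⟨C, -, hC⟩ := FormalMultilinearSeries.norm_mul_pow_le_of_lt_radius _ h1
  refine FormalMultilinearSeries.le_radius_of_eventually_le _ C ?_
  filter_upwards [Filter.eventually_gt_atTop 0] with n hn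
  refine le_trans ?_ (hC n)
  gcongr
  rw [binomialSeries, binomialSeries, FormalMultilinearSeries.ofScalars_norm (E := ℝ)]
  exact FormalMultilinearSeries.ofScalars_norm_le _ _ _ hn

open Matrix in
lemma norm_orthogonal_conj_diagonal {m : ℕ} {Q : Matrix (Fin m) (Fin m) ℝ} (hQ : Qᵀ * Q = 1)
    (x : Fin m → ℝ) : ‖Q * diagonal x * Qᵀ‖ = ‖x‖ := by
  have hQ' : Q * Qᵀ = 1 := mul_eq_one_comm.mp hQ
  have h1 : Q ∈ unitary (Matrix (Fin m) (Fin m) ℝ) := by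
    rw [Unitary.mem_iff, star_eq_conjTranspose, conjTranspose_eq_transpose_of_trivial]
    exact ⟨hQ, hQ'⟩
  have h2 : Qᵀ ∈ unitary (Matrix (Fin m) (Fin m) ℝ) := by
    have := Unitary.star_mem h1
    rwa [star_eq_conjTranspose, conjTranspose_eq_transpose_of_trivial] at this
  rw [CStarRing.norm_mul_mem_unitary _ h2, CStarRing.norm_mem_unitary_mul _ h1,
    l2_opNorm_diagonal]

-- The trace of the k-th power is the k-th power sum of the eigenvalues, so the series can be
-- compared term by term. This writes a symmetric function of the eigenvalues as an analytic
-- function of the matrix, although single eigenvalues need not be smooth.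
open Matrix in
lemma trace_binomialSeries_sum {m : ℕ} {Q : Matrix (Fin m) (Fin m) ℝ} (hQ : Qᵀ * Q = 1)
    {x : Fin m → ℝ} (hx : ‖x‖ < 1) (q : ℝ) :
    ((binomialSeries (Matrix (Fin m) (Fin m) ℝ) q).sum (Q * diagonal x * Qᵀ)).trace =
      ∑ i, (1 + x i) ^ q := by
  set X := Q * diagonal x * Qᵀ with hX
  have hpow : ∀ k : ℕ, X ^ k = Q * diagonal (fun i => x i ^ k) * Qᵀ := by
    intro k
    induction k with
    | zero => simp [mul_eq_one_comm.mp hQ]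
    | succ k ih =>
      rw [pow_succ, ih, hX]
      calc Q * diagonal (fun i => x i ^ k) * Qᵀ * (Q * diagonal x * Qᵀ)
          = Q * (diagonal (fun i => x i ^ k) * (Qᵀ * Q) * diagonal x) * Qᵀ := by
            simp only [Matrix.mul_assoc]
        _ = _ := by
          rw [hQ, Matrix.mul_one, diagonal_mul_diagonal]
          simp only [pow_succ]
  have htr : ∀ k : ℕ, (X ^ k).trace = ∑ i, x i ^ k := by
    intro k
    rw [hpow, trace_mul_comm, ← Matrix.mul_assoc, hQ, Matrix.one_mul, trace_diagonal]
  have hXn : X ∈ Metric.eball (0 : Matrix (Fin m) (Fin m) ℝ)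
      (binomialSeries (Matrix (Fin m) (Fin m) ℝ) q).radius := by
    refine Metric.eball_subset_eball (one_le_radius_binomialSeries_matrix m q) ?_
    rw [mem_eball_zero_iff, ← ofReal_norm, hX, norm_orthogonal_conj_diagonal hQ]
    exact ENNReal.ofReal_lt_one.mpr hx
  have h1 := (binomialSeries (Matrix (Fin m) (Fin m) ℝ) q).hasSum hXn
  have h2 := h1.map (traceLinearMap (Fin m) ℝ ℝ)
    (LinearMap.continuous_of_finiteDimensional _)
  have h3 : HasSum (fun k : ℕ => ∑ i, Ring.choose q k * x i ^ k) (∑ i, (1 + x i) ^ q) := by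
    refine hasSum_sum fun i _ => ?_
    have hxi : x i ∈ Metric.eball (0 : ℝ) 1 := by
      rw [mem_eball_zero_iff, ← ofReal_norm]
      simpa using (norm_le_pi_norm x i).trans_lt hx
    have := (Real.one_add_rpow_hasFPowerSeriesOnBall_zero (a := q)).hasSum hxi
    simpa [binomialSeries, FormalMultilinearSeries.ofScalars_apply_eq, mul_comm] using this
  refine h2.unique ?_
  convert h3 using 2 with k
  simp [binomialSeries, FormalMultilinearSeries.ofScalars_apply_eq, htr, Finset.mul_sum]

open Matrix in
lemma contDiff_gram {n m : ℕ} {k : WithTop ℕ∞} :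
    ContDiff ℝ k (fun M : MatrixSpace n m => M.toMatrixᵀ * M.toMatrix) := by
  have : (fun M : MatrixSpace n m => M.toMatrixᵀ * M.toMatrix) =
      fun M => ∑ i, ∑ j, (∑ l, M (l, i) * M (l, j)) • Matrix.single i j (1 : ℝ) := by
    funext M
    conv_lhs => rw [matrix_eq_sum_single (M.toMatrixᵀ * M.toMatrix)]
    simp [mul_apply, MatrixSpace.toMatrix, smul_single]
  rw [this]
  fun_prop

open Matrix in
/-- Power sums of the shifted squared singular values depend smoothly on the matrix. -/
lemma contDiffAt_spectralPowerSum {n m : ℕ} {ε q : ℝ} {M : MatrixSpace n m}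
    (hM : ∀ i, 0 < matrixSingularValue M.toMatrix i ^ 2 + ε) {k : WithTop ℕ∞} :
    ContDiffAt ℝ k (fun N : MatrixSpace n m => spectralPowerSum ε q N.toMatrix) M := by
  -- The scale `c` exceeds every σᵢ² + ε, so all (σᵢ² + ε) / c lie in (0, 1) and `X M` lies in the
  -- open unit ball, where the binomial series converges.
  set c : ℝ := 1 + ∑ i, (matrixSingularValue M.toMatrix i ^ 2 + ε) with hc
  have hc0 : 0 < c := by
    have := Finset.sum_nonneg fun i (_ : i ∈ Finset.univ) => (hM i).le
    linarith
  have hci : ∀ i, matrixSingularValue M.toMatrix i ^ 2 + ε < c := by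
    intro i
    have := Finset.single_le_sum (fun i _ => (hM i).le) (Finset.mem_univ i)
    linarith
  set X : MatrixSpace n m → Matrix (Fin m) (Fin m) ℝ := fun N =>
    c⁻¹ • (N.toMatrixᵀ * N.toMatrix + ε • (1 : Matrix (Fin m) (Fin m) ℝ)) - 1 with hX
  have hXs : ∀ {l : WithTop ℕ∞}, ContDiff ℝ l X := by
    intro l
    have := contDiff_gram (n := n) (m := m) (k := l)
    fun_prop
  have hXd : ∀ N : MatrixSpace n m, ∃ Q : Matrix (Fin m) (Fin m) ℝ, Qᵀ * Q = 1 ∧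
      X N = Q * diagonal (fun i => c⁻¹ * (matrixSingularValue N.toMatrix i ^ 2 + ε) - 1) * Qᵀ := by
    intro N
    obtain ⟨Q, hQ, hQN⟩ := exists_orthogonal_gram_eq N.toMatrix
    refine ⟨Q, hQ, ?_⟩
    have hQ' : Q * Qᵀ = 1 := mul_eq_one_comm.mp hQ
    have e : diagonal (fun i => c⁻¹ * (matrixSingularValue N.toMatrix i ^ 2 + ε) - 1) =
        c⁻¹ • (diagonal (fun i => matrixSingularValue N.toMatrix i ^ 2) +
          ε • (1 : Matrix (Fin m) (Fin m) ℝ)) - 1 := by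
      ext i j
      by_cases hij : i = j
      · subst hij; simp [mul_add]
      · simp [hij]
    rw [e, hX]
    simp only [hQN, Matrix.mul_sub, Matrix.sub_mul, Matrix.mul_smul, Matrix.smul_mul,
      Matrix.mul_add, Matrix.add_mul, Matrix.mul_one, hQ']
  have hXM : ‖X M‖ < 1 := by
    obtain ⟨Q, hQ, hQM⟩ := hXd M
    rw [hQM, norm_orthogonal_conj_diagonal hQ, pi_norm_lt_iff one_pos]
    intro i
    rw [Real.norm_eq_abs, abs_lt]
    have h1 : 0 < c⁻¹ * (matrixSingularValue M.toMatrix i ^ 2 + ε) :=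
      mul_pos (inv_pos.mpr hc0) (hM i)
    have h2 : c⁻¹ * (matrixSingularValue M.toMatrix i ^ 2 + ε) < 1 := by
      rw [inv_mul_lt_iff₀ hc0, mul_one]; exact hci i
    constructor <;> linarith
  -- The condition ‖X N‖ < 1 is open, so the series represents the power sum on a whole
  -- neighbourhood.
  have hF : ∀ᶠ N in nhds M, spectralPowerSum ε q N.toMatrix =
      c ^ q * ((binomialSeries (Matrix (Fin m) (Fin m) ℝ) q).sum (X N)).trace := by
    have hcont : Continuous fun N => ‖X N‖ := (hXs (l := 0)).continuous.norm
    filter_upwards [hcont.continuousAt.eventually_lt continuousAt_const hXM] with N hN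
    obtain ⟨Q, hQ, hQN⟩ := hXd N
    have hx := hN
    rw [hQN, norm_orthogonal_conj_diagonal hQ] at hx
    rw [hQN, trace_binomialSeries_sum hQ hx, Finset.mul_sum, spectralPowerSum]
    refine Finset.sum_congr rfl fun i _ => ?_
    have hxi := (norm_le_pi_norm _ i).trans_lt hx
    rw [Real.norm_eq_abs, abs_lt] at hxi
    rw [← Real.mul_rpow hc0.le (by linarith [hxi.1])]
    congr 1
    field_simp
    ring
  refine ContDiffAt.congr_of_eventuallyEq ?_ hF
  have hb := (binomialSeries (Matrix (Fin m) (Fin m) ℝ) q).hasFPowerSeriesOnBall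
    (one_pos.trans_le (one_le_radius_binomialSeries_matrix m q))
  have hmem : X M ∈ Metric.eball (0 : Matrix (Fin m) (Fin m) ℝ)
      (binomialSeries (Matrix (Fin m) (Fin m) ℝ) q).radius := by
    refine Metric.eball_subset_eball (one_le_radius_binomialSeries_matrix m q) ?_
    rw [mem_eball_zero_iff, ← ofReal_norm]
    exact ENNReal.ofReal_lt_one.mpr hXM
  have han : ContDiffAt ℝ k (binomialSeries (Matrix (Fin m) (Fin m) ℝ) q).sum (X M) :=
    (hb.analyticAt_of_mem hmem).contDiffAt
  have h2 : ContDiffAt ℝ k (fun N => (binomialSeries (Matrix (Fin m) (Fin m) ℝ) q).sum (X N)) M :=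
    han.comp M hXs.contDiffAt
  have htr := (LinearMap.toContinuousLinearMap (traceLinearMap (Fin m) ℝ ℝ)).contDiff
    (n := k)
  exact contDiffAt_const.mul (htr.contDiffAt.comp M h2)

end

/-! ### Second derivatives along curves -/

/-- First and second derivative of a `C²` function along a curve. -/
lemma hasDerivAt_comp_curve_two {E : Type*} [NormedAddCommGroup E] [NormedSpace ℝ E] {f : E → ℝ}
    {γ γ' : ℝ → E} {t : ℝ} {c : E} (hf : ContDiffAt ℝ 2 f (γ t)) (h1 : ∀ s, HasDerivAt γ (γ' s) s)
    (h2 : HasDerivAt γ' c t) :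
    (∀ᶠ s in nhds t, HasDerivAt (fun s => f (γ s)) (fderiv ℝ f (γ s) (γ' s)) s) ∧
      HasDerivAt (fun s => fderiv ℝ f (γ s) (γ' s))
        (iteratedFDeriv ℝ 2 f (γ t) ![γ' t, γ' t] + fderiv ℝ f (γ t) c) t := by
  constructor
  · have hev : ∀ᶠ y in nhds (γ t), ContDiffAt ℝ 2 f y := hf.eventually (by simp)
    filter_upwards [(h1 t).continuousAt.eventually hev] with s hs
    exact (hs.differentiableAt (by norm_num)).hasFDerivAt.comp_hasDerivAt s (h1 s)
  · have hd : DifferentiableAt ℝ (fderiv ℝ f) (γ t) :=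
      (hf.fderiv_right (m := 1) (by norm_num)).differentiableAt (by norm_num)
    have h3 := hd.hasFDerivAt.comp_hasDerivAt t (h1 t)
    have h4 := h3.clm_apply h2
    rw [iteratedFDeriv_two_apply]
    simpa using h4

/-- If a `C²` function is constant along an elliptic arc, its second derivative in the initial
direction is balanced by its first derivative in the direction of the acceleration. -/
lemma iteratedFDeriv_two_add_fderiv_eq_zero {E : Type*} [NormedAddCommGroup E] [NormedSpace ℝ E]
    {f : E → ℝ} {x A B : E} (hf : ContDiffAt ℝ 2 f x)
    (hconst : ∀ t : ℝ, f (x + Real.sin t • A + (1 - Real.cos t) • B) = f x) :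
    iteratedFDeriv ℝ 2 f x ![A, A] + fderiv ℝ f x B = 0 := by
  set γ : ℝ → E := fun t => x + Real.sin t • A + (1 - Real.cos t) • B with hγ
  -- At time 0 the arc has velocity `A` and acceleration `B`.
  have hγ0 : γ 0 = x := by simp [hγ]
  have h1 : ∀ s, HasDerivAt γ (Real.cos s • A + Real.sin s • B) s := by
    intro s
    have ha := (Real.hasDerivAt_sin s).smul_const A
    have hb := ((Real.hasDerivAt_cos s).const_sub 1).smul_const B
    have h : HasDerivAt γ _ s := (ha.const_add x).fun_add hb
    simpa using h
  have h2 : HasDerivAt (fun s => Real.cos s • A + Real.sin s • B) B 0 := by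
    have ha := (Real.hasDerivAt_cos 0).smul_const A
    have hb := (Real.hasDerivAt_sin 0).smul_const B
    simpa using ha.fun_add hb
  obtain ⟨h3, h4⟩ := hasDerivAt_comp_curve_two (f := f) (γ := γ) (by rwa [hγ0]) h1 h2
  have h5 : (fun s => fderiv ℝ f (γ s) (Real.cos s • A + Real.sin s • B)) =ᶠ[nhds 0] fun _ => 0 := by
    filter_upwards [h3] with s hs
    refine hs.unique ?_
    simpa only [hγ, hconst] using hasDerivAt_const s (f x)
  have h6 := h4.unique ((hasDerivAt_const (0 : ℝ) (0 : ℝ)).congr_of_eventuallyEq h5)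
  simpa [hγ0] using h6

/-- Transfers derivatives of an explicit one-variable formula `κ` to the function on the line.
Differentiability of `κ` is required only near 0, since the power formulas used later are
differentiated only while the moving singular value stays positive. -/
lemma iteratedFDeriv_two_line {E : Type*} [NormedAddCommGroup E] [NormedSpace ℝ E]
    {f : E → ℝ} {x A : E} (hf : ContDiffAt ℝ 2 f x) {κ κ' : ℝ → ℝ} {κ'' : ℝ}
    (hκ : ∀ t : ℝ, f (x + t • A) = κ t) (h1 : ∀ᶠ t in nhds 0, HasDerivAt κ (κ' t) t)
    (h2 : HasDerivAt κ' κ'' 0) :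
    fderiv ℝ f x A = κ' 0 ∧ iteratedFDeriv ℝ 2 f x ![A, A] = κ'' := by
  set γ : ℝ → E := fun t => x + t • A with hγ
  have hγ0 : γ 0 = x := by simp [hγ]
  have h1' : ∀ s, HasDerivAt γ A s := by
    intro s
    have h : HasDerivAt γ _ s := ((hasDerivAt_id s).smul_const A).const_add x
    simpa using h
  obtain ⟨h3, h4⟩ := hasDerivAt_comp_curve_two (f := f) (γ := γ) (t := 0) (by rwa [hγ0]) h1'
    (hasDerivAt_const 0 A)
  have h5 : (fun s => fderiv ℝ f (γ s) A) =ᶠ[nhds 0] κ' := by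
    filter_upwards [h3, h1] with s hs hs'
    refine hs.unique ?_
    simpa only [hγ, hκ] using hs'
  refine ⟨by simpa [hγ0] using h5.self_of_nhds, ?_⟩
  simpa [hγ0] using h4.unique (h2.congr_of_eventuallyEq h5)

/-! ### Matrix coordinates and plane rotations of diagonal matrices -/

section toMatrix
variable {n m : ℕ}

@[simp] lemma MatrixSpace.toMatrix_add (M N : MatrixSpace n m) :
    (M + N).toMatrix = M.toMatrix + N.toMatrix := by
  ext; simp [MatrixSpace.toMatrix]

@[simp] lemma MatrixSpace.toMatrix_sub (M N : MatrixSpace n m) :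
    (M - N).toMatrix = M.toMatrix - N.toMatrix := by
  ext; simp [MatrixSpace.toMatrix]

@[simp] lemma MatrixSpace.toMatrix_neg (M : MatrixSpace n m) :
    MatrixSpace.toMatrix (-M) = -M.toMatrix := by
  ext; simp [MatrixSpace.toMatrix]

@[simp] lemma MatrixSpace.toMatrix_smul (c : ℝ) (M : MatrixSpace n m) :
    MatrixSpace.toMatrix (c • M) = c • M.toMatrix := by
  ext; simp [MatrixSpace.toMatrix]

@[simp] lemma MatrixSpace.toMatrix_single (i : Fin n) (j : Fin m) (c : ℝ) :
    MatrixSpace.toMatrix (EuclideanSpace.single (i, j) c) = Matrix.single i j c := by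
  ext k l
  simp only [MatrixSpace.toMatrix, Matrix.of_apply, Matrix.single_apply, PiLp.single_apply,
    Prod.mk.injEq]
  by_cases h : i = k ∧ j = l
  · rw [if_pos h, if_pos ⟨h.1.symm, h.2.symm⟩]
  · rw [if_neg h, if_neg fun h' => h ⟨h'.1.symm, h'.2.symm⟩]

end toMatrix

section

open Matrix

/-- The rotation by `θ` in the plane of the `i`-th and `j`-th coordinate. -/
noncomputable def planeRotation {k : ℕ} (i j : Fin k) (θ : ℝ) : Matrix (Fin k) (Fin k) ℝ :=
  1 + (Real.cos θ - 1) • (single i i (1 : ℝ) + single j j (1 : ℝ)) +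
    Real.sin θ • (single j i (1 : ℝ) - single i j (1 : ℝ))

lemma planeRotation_transpose {k : ℕ} (i j : Fin k) (θ : ℝ) :
    (planeRotation i j θ)ᵀ = planeRotation i j (-θ) := by
  simp only [planeRotation, transpose_add, transpose_smul, transpose_sub, transpose_one,
    transpose_single, Real.cos_neg, Real.sin_neg]
  module

lemma planeRotation_transpose_mul_self {k : ℕ} {i j : Fin k} (hij : i ≠ j) (θ : ℝ) :
    (planeRotation i j θ)ᵀ * planeRotation i j θ = 1 := by
  have h := Real.sin_sq_add_cos_sq θ
  rw [planeRotation_transpose]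
  simp only [planeRotation, Real.cos_neg, Real.sin_neg, Matrix.add_mul,
    Matrix.mul_add, Matrix.one_mul, Matrix.smul_mul, Matrix.mul_smul,
    Matrix.sub_mul, Matrix.mul_sub, single_mul_single_same, mul_one,
    single_mul_single_of_ne _ _ _ _ hij, single_mul_single_of_ne _ _ _ _ hij.symm]
  match_scalars <;> first | ring1 | linear_combination h

lemma single_mul_rectDiagonal {n m : ℕ} (hmn : m ≤ n) {k : ℕ} (i : Fin k) (b : Fin m)
    (s : Fin m → ℝ) :
    single i (Fin.castLE hmn b) (1 : ℝ) * rectDiagonal n s = s b • single i b (1 : ℝ) := by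
  ext p q
  rw [mul_apply, Finset.sum_eq_single (Fin.castLE hmn b)]
  · simp only [Matrix.single_apply, rectDiagonal, of_apply, Matrix.smul_apply, Fin.val_castLE]
    by_cases hb : b = q
    · subst hb; simp
    · have : (b : ℕ) ≠ q := fun h => hb (Fin.ext h)
      simp [hb, this]
  · intro l _ hl
    simp [hl.symm]
  · simp

lemma single_mul_rectDiagonal_of_le {n m : ℕ} {k : ℕ} (i : Fin k) {b : Fin n} (hb : m ≤ (b : ℕ))
    (s : Fin m → ℝ) :
    single i b (1 : ℝ) * rectDiagonal n s = 0 := by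
  ext p q
  rw [mul_apply, Finset.sum_eq_zero, Matrix.zero_apply]
  intro l _
  have : (b : ℕ) ≠ q := by omega
  by_cases hl : b = l
  · subst hl; simp [rectDiagonal, this]
  · simp [hl]

lemma rectDiagonal_mul_single {n m : ℕ} (hmn : m ≤ n) {k : ℕ} (a : Fin m) (j : Fin k)
    (s : Fin m → ℝ) :
    rectDiagonal n s * single a j (1 : ℝ) = s a • single (Fin.castLE hmn a) j (1 : ℝ) := by
  ext p q
  rw [mul_apply, Finset.sum_eq_single a]
  · simp only [Matrix.single_apply, rectDiagonal, of_apply, Matrix.smul_apply]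
    by_cases hp : (p : ℕ) = a
    · have : Fin.castLE hmn a = p := Fin.ext hp.symm
      simp [hp, this]
    · have : Fin.castLE hmn a ≠ p := fun h => hp (by rw [← h]; rfl)
      simp [hp, this]
  · intro l _ hl
    simp [hl.symm]
  · simp

/-- The entries of the product are quadratic in cos θ and sin θ; the double angle formulas turn the
orbit into an elliptic arc with parameter 2θ, as `iteratedFDeriv_two_add_fderiv_eq_zero` requires.
Opposite angles on the two sides give the symmetric off-diagonal direction. -/
lemma rotation_conj_rectDiagonal {n m : ℕ} (hmn : m ≤ n) {a b : Fin m} (hab : a ≠ b)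
    (s : Fin m → ℝ) (θ : ℝ) :
    rectDiagonal n s + Real.sin (2 * θ) • (((s a - s b) / 2) •
      (single (Fin.castLE hmn a) b (1 : ℝ) + single (Fin.castLE hmn b) a (1 : ℝ))) +
      (1 - Real.cos (2 * θ)) • ((-((s a - s b) / 2)) •
      (single (Fin.castLE hmn a) a (1 : ℝ) - single (Fin.castLE hmn b) b (1 : ℝ))) =
    planeRotation (Fin.castLE hmn a) (Fin.castLE hmn b) θ * rectDiagonal n s *
      planeRotation a b (-θ) := by
  have h := Real.sin_sq_add_cos_sq θ
  simp only [planeRotation, Real.cos_neg, Real.sin_neg, Matrix.add_mul,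
    Matrix.mul_add, Matrix.one_mul, Matrix.mul_one, Matrix.smul_mul, Matrix.mul_smul,
    Matrix.sub_mul, Matrix.mul_sub, single_mul_single_same, mul_one,
    single_mul_single_of_ne _ _ _ _ hab, single_mul_single_of_ne _ _ _ _ hab.symm,
    single_mul_rectDiagonal, rectDiagonal_mul_single hmn, Real.sin_two_mul, Real.cos_two_mul]
  match_scalars
  all_goals first
    | ring1
    | linear_combination (s a) * h
    | linear_combination (s b) * h
    | linear_combination (-s b) * h
    | linear_combination (-s a) * h

/-- Equal angles on the two sides give the antisymmetric off-diagonal direction. -/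
lemma rotation_twist_rectDiagonal {n m : ℕ} (hmn : m ≤ n) {a b : Fin m} (hab : a ≠ b)
    (s : Fin m → ℝ) (θ : ℝ) :
    rectDiagonal n s + Real.sin (2 * θ) • (((s a + s b) / 2) •
      (single (Fin.castLE hmn b) a (1 : ℝ) - single (Fin.castLE hmn a) b (1 : ℝ))) +
      (1 - Real.cos (2 * θ)) • ((-((s a + s b) / 2)) •
      (single (Fin.castLE hmn a) a (1 : ℝ) + single (Fin.castLE hmn b) b (1 : ℝ))) =
    planeRotation (Fin.castLE hmn a) (Fin.castLE hmn b) θ * rectDiagonal n s *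
      planeRotation a b θ := by
  have h := Real.sin_sq_add_cos_sq θ
  simp only [planeRotation, Matrix.add_mul,
    Matrix.mul_add, Matrix.one_mul, Matrix.mul_one, Matrix.smul_mul, Matrix.mul_smul,
    Matrix.sub_mul, Matrix.mul_sub, single_mul_single_same, mul_one,
    single_mul_single_of_ne _ _ _ _ hab, single_mul_single_of_ne _ _ _ _ hab.symm,
    single_mul_rectDiagonal, rectDiagonal_mul_single hmn, Real.sin_two_mul, Real.cos_two_mul]
  match_scalars
  all_goals first
    | ring1
    | linear_combination (s a) * h
    | linear_combination (s b) * h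

/-- Rotating row `a` against one of the zero rows below the square block needs no rotation of the
columns. -/
lemma rotation_mul_rectDiagonal {n m : ℕ} (hmn : m ≤ n) (a : Fin m) {i : Fin n}
    (hi : m ≤ (i : ℕ)) (s : Fin m → ℝ) (θ : ℝ) :
    rectDiagonal n s + Real.sin θ • (s a • single i a (1 : ℝ)) +
      (1 - Real.cos θ) • (-s a) • single (Fin.castLE hmn a) a (1 : ℝ) =
    planeRotation (Fin.castLE hmn a) i θ * rectDiagonal n s := by
  simp only [planeRotation, Matrix.add_mul, Matrix.one_mul, Matrix.smul_mul, Matrix.sub_mul,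
    single_mul_rectDiagonal, single_mul_rectDiagonal_of_le _ hi]
  module

lemma rectDiagonal_add_single {n m : ℕ} (hmn : m ≤ n) (a : Fin m) (s : Fin m → ℝ) (t : ℝ) :
    rectDiagonal n s + t • single (Fin.castLE hmn a) a (1 : ℝ) =
      rectDiagonal n (Function.update s a (s a + t)) := by
  ext p q
  simp only [rectDiagonal, Matrix.add_apply, of_apply, Matrix.smul_apply, single_apply, Function.update_apply]
  by_cases hq : q = a
  · subst hq
    by_cases hp : (p : ℕ) = q
    · have : Fin.castLE hmn q = p := Fin.ext hp.symm
      simp [hp, this]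
    · have : Fin.castLE hmn q ≠ p := fun h => hp (by rw [← h]; rfl)
      simp [hp, this]
  · simp [hq, Ne.symm hq]

end

/-! ### The Laplacian of a bi-orthogonally invariant function -/

section

open Matrix

lemma MatrixSpace.toMatrix_injective {n m : ℕ} {M N : MatrixSpace n m}
    (h : M.toMatrix = N.toMatrix) : M = N := by
  ext ⟨i, j⟩
  exact congrFun (congrFun h i) j

lemma MatrixSpace.exists_toMatrix_eq {n m : ℕ} (A : Matrix (Fin n) (Fin m) ℝ) :
    ∃ M : MatrixSpace n m, M.toMatrix = A :=
  ⟨WithLp.toLp 2 fun x => A x.1 x.2, by ext; simp [MatrixSpace.toMatrix]⟩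

/-- A function on a matrix space that is invariant under orthogonal changes of coordinates on both
sides. -/
def IsBiorthogonallyInvariant {n m : ℕ} (h : MatrixSpace n m → ℝ) : Prop :=
  ∀ (U : Matrix (Fin n) (Fin n) ℝ) (V : Matrix (Fin m) (Fin m) ℝ) (M N : MatrixSpace n m),
    Uᵀ * U = 1 → Vᵀ * V = 1 → N.toMatrix = U * M.toMatrix * V → h N = h M

/-- The factor (s a - s b) / 2 scales both velocity and acceleration of the arc; it stays on both
sides because it may vanish. -/
lemma iteratedFDeriv_two_symm_entry {n m : ℕ} (hmn : m ≤ n) {h : MatrixSpace n m → ℝ}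
    (hinv : IsBiorthogonallyInvariant h) {D : MatrixSpace n m} {s : Fin m → ℝ}
    (hD : D.toMatrix = rectDiagonal n s) (hh : ContDiffAt ℝ 2 h D)
    {a b : Fin m} (hab : a ≠ b) :
    (s a - s b) / 2 * iteratedFDeriv ℝ 2 h D
      ![EuclideanSpace.single (Fin.castLE hmn a, b) (1 : ℝ) +
          EuclideanSpace.single (Fin.castLE hmn b, a) (1 : ℝ),
        EuclideanSpace.single (Fin.castLE hmn a, b) (1 : ℝ) +
          EuclideanSpace.single (Fin.castLE hmn b, a) (1 : ℝ)] * ((s a - s b) / 2) =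
      (s a - s b) / 2 * (fderiv ℝ h D (EuclideanSpace.single (Fin.castLE hmn a, a) (1 : ℝ)) -
        fderiv ℝ h D (EuclideanSpace.single (Fin.castLE hmn b, b) (1 : ℝ))) := by
  have key := iteratedFDeriv_two_add_fderiv_eq_zero (f := h) (x := D)
    (A := ((s a - s b) / 2) • (EuclideanSpace.single (Fin.castLE hmn a, b) (1 : ℝ) +
          EuclideanSpace.single (Fin.castLE hmn b, a) (1 : ℝ)))
    (B := (-((s a - s b) / 2)) • (EuclideanSpace.single (Fin.castLE hmn a, a) (1 : ℝ) -
          EuclideanSpace.single (Fin.castLE hmn b, b) (1 : ℝ))) hh (by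
      intro t
      refine hinv _ _ _ _ (planeRotation_transpose_mul_self
        (fun e => hab (Fin.castLE_injective hmn e)) (t / 2))
        (planeRotation_transpose_mul_self hab (-(t / 2))) ?_
      rw [hD, ← rotation_conj_rectDiagonal hmn hab]
      simp [hD, mul_div_cancel₀])
  rw [iteratedFDeriv_two_apply] at key ⊢
  simp only [Matrix.cons_val_zero, Matrix.cons_val_one, map_smul, map_sub,
    _root_.smul_apply, smul_eq_mul] at key ⊢
  linear_combination key

lemma iteratedFDeriv_two_antisymm_entry {n m : ℕ} (hmn : m ≤ n) {h : MatrixSpace n m → ℝ}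
    (hinv : IsBiorthogonallyInvariant h) {D : MatrixSpace n m} {s : Fin m → ℝ}
    (hD : D.toMatrix = rectDiagonal n s) (hh : ContDiffAt ℝ 2 h D)
    {a b : Fin m} (hab : a ≠ b) :
    (s a + s b) / 2 * iteratedFDeriv ℝ 2 h D
      ![EuclideanSpace.single (Fin.castLE hmn b, a) (1 : ℝ) -
          EuclideanSpace.single (Fin.castLE hmn a, b) (1 : ℝ),
        EuclideanSpace.single (Fin.castLE hmn b, a) (1 : ℝ) -
          EuclideanSpace.single (Fin.castLE hmn a, b) (1 : ℝ)] * ((s a + s b) / 2) =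
      (s a + s b) / 2 * (fderiv ℝ h D (EuclideanSpace.single (Fin.castLE hmn a, a) (1 : ℝ)) +
        fderiv ℝ h D (EuclideanSpace.single (Fin.castLE hmn b, b) (1 : ℝ))) := by
  have key := iteratedFDeriv_two_add_fderiv_eq_zero (f := h) (x := D)
    (A := ((s a + s b) / 2) • (EuclideanSpace.single (Fin.castLE hmn b, a) (1 : ℝ) -
          EuclideanSpace.single (Fin.castLE hmn a, b) (1 : ℝ)))
    (B := (-((s a + s b) / 2)) • (EuclideanSpace.single (Fin.castLE hmn a, a) (1 : ℝ) +
          EuclideanSpace.single (Fin.castLE hmn b, b) (1 : ℝ))) hh (by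
      intro t
      refine hinv _ _ _ _ (planeRotation_transpose_mul_self
        (fun e => hab (Fin.castLE_injective hmn e)) (t / 2))
        (planeRotation_transpose_mul_self hab (t / 2)) ?_
      rw [hD, ← rotation_twist_rectDiagonal hmn hab]
      simp [hD, mul_div_cancel₀])
  rw [iteratedFDeriv_two_apply] at key ⊢
  simp only [Matrix.cons_val_zero, Matrix.cons_val_one, map_smul, map_add,
    _root_.smul_apply, smul_eq_mul] at key ⊢
  linear_combination key

/-- Adding the symmetric and antisymmetric identities cancels the mixed second derivatives, and (p -
q) / (s a - s b) + (p + q) / (s a + s b) = 2 (s a p - s b q) / (s a ² - s b ²). -/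
lemma iteratedFDeriv_two_offDiagonal_add {n m : ℕ} (hmn : m ≤ n) {h : MatrixSpace n m → ℝ}
    (hinv : IsBiorthogonallyInvariant h) {D : MatrixSpace n m} {s : Fin m → ℝ}
    (hD : D.toMatrix = rectDiagonal n s) (hh : ContDiffAt ℝ 2 h D)
    {a b : Fin m} (ha : 0 < s a) (hb : 0 < s b)
    (hab : s a ≠ s b) :
    iteratedFDeriv ℝ 2 h D
      ![EuclideanSpace.single (Fin.castLE hmn a, b) (1 : ℝ),
        EuclideanSpace.single (Fin.castLE hmn a, b) (1 : ℝ)] +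
    iteratedFDeriv ℝ 2 h D
      ![EuclideanSpace.single (Fin.castLE hmn b, a) (1 : ℝ),
        EuclideanSpace.single (Fin.castLE hmn b, a) (1 : ℝ)] =
    2 * ((s a * fderiv ℝ h D (EuclideanSpace.single (Fin.castLE hmn a, a) (1 : ℝ)) -
      s b * fderiv ℝ h D (EuclideanSpace.single (Fin.castLE hmn b, b) (1 : ℝ))) /
        (s a ^ 2 - s b ^ 2)) := by
  have hne : a ≠ b := fun e => hab (by rw [e])
  have h1 := iteratedFDeriv_two_symm_entry hmn hinv hD hh hne
  have h2 := iteratedFDeriv_two_antisymm_entry hmn hinv hD hh hne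
  simp only [iteratedFDeriv_two_apply, Matrix.cons_val_zero, Matrix.cons_val_one, map_add, map_sub,
    _root_.add_apply, _root_.sub_apply] at h1 h2 ⊢
  generalize fderiv ℝ h D (EuclideanSpace.single (Fin.castLE hmn a, a) (1 : ℝ)) = p at *
  generalize fderiv ℝ h D (EuclideanSpace.single (Fin.castLE hmn b, b) (1 : ℝ)) = q at *
  generalize (fderiv ℝ (fderiv ℝ h) D (EuclideanSpace.single (Fin.castLE hmn a, b) (1 : ℝ)))
    (EuclideanSpace.single (Fin.castLE hmn a, b) (1 : ℝ)) = x at *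
  generalize (fderiv ℝ (fderiv ℝ h) D (EuclideanSpace.single (Fin.castLE hmn b, a) (1 : ℝ)))
    (EuclideanSpace.single (Fin.castLE hmn b, a) (1 : ℝ)) = y at *
  generalize (fderiv ℝ (fderiv ℝ h) D (EuclideanSpace.single (Fin.castLE hmn a, b) (1 : ℝ)))
    (EuclideanSpace.single (Fin.castLE hmn b, a) (1 : ℝ)) = z at *
  generalize (fderiv ℝ (fderiv ℝ h) D (EuclideanSpace.single (Fin.castLE hmn b, a) (1 : ℝ)))
    (EuclideanSpace.single (Fin.castLE hmn a, b) (1 : ℝ)) = w at *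
  have e1 : s a - s b ≠ 0 := sub_ne_zero.mpr hab
  have e2 : s a + s b ≠ 0 := by positivity
  have h1' : (s a - s b) * (x + y + z + w) = 2 * (p - q) := by
    apply mul_left_cancel₀ e1; linear_combination 4 * h1
  have h2' : (s a + s b) * (x + y - z - w) = 2 * (p + q) := by
    apply mul_left_cancel₀ e2; linear_combination 4 * h2
  have e3 : s a ^ 2 - s b ^ 2 ≠ 0 := by
    rw [sq_sub_sq]; exact mul_ne_zero e2 e1
  rw [mul_div_assoc', eq_div_iff e3]
  linear_combination (s a + s b) / 2 * h1' + (s a - s b) / 2 * h2'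

lemma iteratedFDeriv_two_lower_entry {n m : ℕ} (hmn : m ≤ n) {h : MatrixSpace n m → ℝ}
    (hinv : IsBiorthogonallyInvariant h) {D : MatrixSpace n m} {s : Fin m → ℝ}
    (hD : D.toMatrix = rectDiagonal n s) (hh : ContDiffAt ℝ 2 h D)
    {a : Fin m} {i : Fin n} (hi : m ≤ (i : ℕ)) (ha : 0 < s a) :
    iteratedFDeriv ℝ 2 h D
      ![EuclideanSpace.single (i, a) (1 : ℝ), EuclideanSpace.single (i, a) (1 : ℝ)] =
    fderiv ℝ h D (EuclideanSpace.single (Fin.castLE hmn a, a) (1 : ℝ)) / s a := by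
  have key := iteratedFDeriv_two_add_fderiv_eq_zero (f := h) (x := D)
    (A := s a • EuclideanSpace.single (i, a) (1 : ℝ))
    (B := (-s a) • EuclideanSpace.single (Fin.castLE hmn a, a) (1 : ℝ)) hh (by
      intro t
      have hne : Fin.castLE hmn a ≠ i := fun e => by
        have : (a : ℕ) = i := congrArg Fin.val e
        omega
      refine hinv (planeRotation (Fin.castLE hmn a) i t) 1 _ _
        (planeRotation_transpose_mul_self hne t) (by simp) ?_
      rw [hD, Matrix.mul_one, ← rotation_mul_rectDiagonal hmn a hi]
      simp [hD])
  rw [iteratedFDeriv_two_apply] at key ⊢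
  simp only [Matrix.cons_val_zero, Matrix.cons_val_one, map_smul,
    _root_.smul_apply, smul_eq_mul] at key ⊢
  rw [eq_div_iff ha.ne']
  apply mul_left_cancel₀ ha.ne'
  linear_combination key

/-- The Laplacian of a bi-orthogonally invariant function in terms of its first and second partial
derivatives with respect to the singular values, at a point with distinct positive singular
values. -/
theorem matrixLaplacian_eq_of_rectDiagonal {n m : ℕ} (hmn : m ≤ n) {h : MatrixSpace n m → ℝ}
    (hinv : IsBiorthogonallyInvariant h) {D : MatrixSpace n m} {s : Fin m → ℝ}
    (hD : D.toMatrix = rectDiagonal n s) (hh : ContDiffAt ℝ 2 h D)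
    (hpos : ∀ a, 0 < s a) (hs : Function.Injective s) :
    matrixLaplacian h D =
      ∑ a, iteratedFDeriv ℝ 2 h D ![EuclideanSpace.single (Fin.castLE hmn a, a) (1 : ℝ),
        EuclideanSpace.single (Fin.castLE hmn a, a) (1 : ℝ)] +
      ((n : ℝ) - m) * ∑ a, fderiv ℝ h D (EuclideanSpace.single (Fin.castLE hmn a, a) (1 : ℝ)) / s a +
      ∑ a, ∑ b, (s a * fderiv ℝ h D (EuclideanSpace.single (Fin.castLE hmn a, a) (1 : ℝ)) -
        s b * fderiv ℝ h D (EuclideanSpace.single (Fin.castLE hmn b, b) (1 : ℝ))) /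
        (s a ^ 2 - s b ^ 2) := by
  have hlow := fun (a : Fin m) (i : Fin n) (hi : m ≤ (i : ℕ)) =>
    iteratedFDeriv_two_lower_entry hmn hinv hD hh hi (hpos a)
  have hoff := fun (a b : Fin m) (hab : a ≠ b) =>
    iteratedFDeriv_two_offDiagonal_add hmn hinv hD hh (hpos a) (hpos b) (hs.ne hab)
  rw [matrixLaplacian]
  set H : Fin n → Fin m → ℝ := fun i j => iteratedFDeriv ℝ 2 h D
    ![EuclideanSpace.single (i, j) (1 : ℝ), EuclideanSpace.single (i, j) (1 : ℝ)] with hH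
  set k : Fin m → ℝ := fun a =>
    fderiv ℝ h D (EuclideanSpace.single (Fin.castLE hmn a, a) (1 : ℝ)) with hk
  have hlow' : ∀ (a : Fin m) (i : Fin n), m ≤ (i : ℕ) → H i a = k a / s a := hlow
  have hoff' : ∀ a b : Fin m, a ≠ b → H (Fin.castLE hmn a) b + H (Fin.castLE hmn b) a =
      2 * ((s a * k a - s b * k b) / (s a ^ 2 - s b ^ 2)) := hoff
  change ∑ i, ∑ j, H i j = ∑ a, H (Fin.castLE hmn a) a + ((n : ℝ) - m) * ∑ a, k a / s a +
    ∑ a, ∑ b, (s a * k a - s b * k b) / (s a ^ 2 - s b ^ 2)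
  clear_value H k
  clear hlow hoff hH hk hinv hD hh
  -- The rows split into the square block and the l = n - m rows below it.
  obtain ⟨l, rfl⟩ := Nat.exists_eq_add_of_le hmn
  rw [Fin.sum_univ_add]
  have h1 : ∑ i : Fin l, ∑ j, H (Fin.natAdd m i) j = ((m + l : ℕ) - m : ℝ) * ∑ a, k a / s a := by
    rw [Finset.sum_congr rfl fun i _ => Finset.sum_congr rfl fun j _ => hlow' j _ (by simp)]
    simp
  have h2 : ∑ a : Fin m, ∑ b, H (Fin.castLE hmn a) b = ∑ a, H (Fin.castLE hmn a) a +
      ∑ a, ∑ b, (s a * k a - s b * k b) / (s a ^ 2 - s b ^ 2) := by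
    -- Only the sum of the entries (a, b) and (b, a) is known, so the double sum is symmetrised. For
    -- a = b the quotient is 0 / 0 = 0, and the diagonal second derivatives are added separately.
    have h3 : 2 * ∑ a : Fin m, ∑ b, H (Fin.castLE hmn a) b =
        ∑ a : Fin m, ∑ b, (H (Fin.castLE hmn a) b + H (Fin.castLE hmn b) a) := by
      simp only [Finset.sum_add_distrib]
      rw [Finset.sum_comm (f := fun a b => H (Fin.castLE hmn b) a)]
      ring
    have h4 : ∀ a b : Fin m, H (Fin.castLE hmn a) b + H (Fin.castLE hmn b) a =
        2 * ((s a * k a - s b * k b) / (s a ^ 2 - s b ^ 2)) +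
          if a = b then 2 * H (Fin.castLE hmn a) a else 0 := by
      intro a b
      by_cases hab : a = b
      · subst hab; simp; ring
      · rw [hoff' a b hab, if_neg hab, add_zero]
    simp only [h4, Finset.sum_add_distrib, Finset.sum_ite_eq, Finset.mem_univ, if_true,
      ← Finset.mul_sum] at h3
    linarith
  have h5 : ∀ a : Fin m, Fin.castAdd l a = Fin.castLE hmn a := fun a => rfl
  simp only [h5, h1, h2]
  ring

end

/-! ### Inequalities between power sums -/

/-- The trapezoidal rule underestimates the integral of the concave derivative of `x ^ p`. -/
lemma rpow_trapezoid {p x y : ℝ} (hp1 : 1 ≤ p) (hp2 : p ≤ 2) (hy : 0 < y) (hxy : y ≤ x) :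
    p / 2 * (x ^ (p - 1) + y ^ (p - 1)) * (x - y) ≤ x ^ p - y ^ p := by
  set f : ℝ → ℝ := fun x => x ^ p - y ^ p - p / 2 * (x ^ (p - 1) + y ^ (p - 1)) * (x - y) with hf
  have hd : ∀ z, 0 < z → HasDerivAt f (p * z ^ (p - 1) - (p / 2 * ((p - 1) * z ^ (p - 1 - 1)) * (z - y)
      + p / 2 * (z ^ (p - 1) + y ^ (p - 1)) * 1)) z := by
    intro z hz
    have h1 := (Real.hasDerivAt_rpow_const (p := p) (Or.inl hz.ne')).sub_const (y ^ p)
    have h2 := ((Real.hasDerivAt_rpow_const (p := p - 1) (Or.inl hz.ne')).add_const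
      (y ^ (p - 1))).const_mul (p / 2)
    exact h1.fun_sub (h2.fun_mul ((hasDerivAt_id z).sub_const y))
  have hmono : MonotoneOn f (Set.Ici y) := by
    refine monotoneOn_of_deriv_nonneg (convex_Ici y) ?_ ?_ ?_
    · exact fun z hz => (hd z (hy.trans_le hz)).continuousAt.continuousWithinAt
    · rw [interior_Ici]
      exact fun z hz => (hd z (hy.trans hz)).differentiableAt.differentiableWithinAt
    · rw [interior_Ici]
      intro z hz
      have hz0 : 0 < z := hy.trans hz
      rw [(hd z hz0).deriv]
      -- Bernoulli's inequality puts the concave function x^(p-1) below its tangent at `z`,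
      -- evaluated at `y`; this is exactly nonnegativity of the derivative of `f`.
      have hb := rpow_one_add_le_one_add_mul_self (s := y / z - 1) (p := p - 1)
        (by linarith [div_pos hy hz0]) (by linarith) (by linarith)
      rw [add_sub_cancel, Real.div_rpow hy.le hz0.le, div_le_iff₀ (Real.rpow_pos_of_pos hz0 _)] at hb
      have e : z ^ (p - 1) = z ^ (p - 1 - 1) * z := by
        rw [← Real.rpow_add_one hz0.ne']; congr 1; ring
      have hb' : y ^ (p - 1) ≤ z ^ (p - 1) - (p - 1) * z ^ (p - 1 - 1) * (z - y) := by
        refine hb.trans_eq ?_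
        rw [e]
        field_simp
        ring
      nlinarith
  have := hmono Set.self_mem_Ici hxy hxy
  simp only [hf] at this
  nlinarith

/-- The difference quotient of `x ^ q`. -/
noncomputable def rpowQuotient (q x y : ℝ) : ℝ := (x ^ q - y ^ q) / (x - y)

lemma rpowQuotient_comm (q x y : ℝ) : rpowQuotient q x y = rpowQuotient q y x := by
  rw [rpowQuotient, rpowQuotient, ← neg_sub, ← neg_sub y x, neg_div_neg_eq]

lemma rpowQuotient_nonneg {q x y : ℝ} (hq : 0 ≤ q) (hx : 0 ≤ x) (hy : 0 ≤ y) :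
    0 ≤ rpowQuotient q x y := by
  rcases le_total x y with h | h
  · rw [rpowQuotient_comm]
    exact div_nonneg (sub_nonneg.mpr (Real.rpow_le_rpow hx h hq)) (sub_nonneg.mpr h)
  · exact div_nonneg (sub_nonneg.mpr (Real.rpow_le_rpow hy h hq)) (sub_nonneg.mpr h)

lemma rpowQuotient_anti {q x y z : ℝ} (hq0 : 0 ≤ q) (hq1 : q ≤ 1) (hx : 0 ≤ x) (hxy : x ≤ y)
    (hz : 0 ≤ z) (hzx : x ≠ z) (hzy : y ≠ z) : rpowQuotient q y z ≤ rpowQuotient q x z := by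
  have h := (Real.concaveOn_rpow hq0 hq1).slope_anti (show z ∈ Set.Ici 0 from hz)
    (show x ∈ Set.Ici 0 \ {z} from ⟨hx, hzx⟩) (show y ∈ Set.Ici 0 \ {z} from ⟨hx.trans hxy, hzy⟩) hxy
  simpa [slope_def_field, rpowQuotient] using h

/-- Since (x^q + y^q)(x^q - y^q) = x^(2q) - y^(2q), this is the trapezoidal bound with p = 2q. -/
lemma rpowQuotient_mul_add_ge {q x y : ℝ} (hq : 1 / 2 ≤ q) (hq1 : q ≤ 1) (hx : 0 < x) (hy : 0 < y)
    (hxy : x ≠ y) :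
    q * (x ^ (2 * q - 1) + y ^ (2 * q - 1)) ≤ (x ^ q + y ^ q) * rpowQuotient q x y := by
  wlog h : y ≤ x generalizing x y
  · rw [rpowQuotient_comm, add_comm (x ^ q), add_comm (x ^ (2 * q - 1))]
    exact this hy hx hxy.symm (le_of_not_ge h)
  have hlt : 0 < x - y := sub_pos.mpr (lt_of_le_of_ne h hxy.symm)
  have := rpow_trapezoid (p := 2 * q) (by linarith) (by linarith) hy h
  have ex : ∀ z : ℝ, 0 < z → z ^ (2 * q) = z ^ q * z ^ q := fun z hz => by
    rw [← Real.rpow_add hz, two_mul]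
  rw [ex x hx, ex y hy] at this
  rw [rpowQuotient, mul_div_assoc', le_div_iff₀ hlt]
  linarith

-- Chebyshev's sum inequality: μ^q increases with μ while μ^(q-1) decreases.
open Finset in
lemma card_mul_sum_rpow_le {m : ℕ} {q : ℝ} (hq0 : 0 ≤ q) (hq1 : q ≤ 1) {μ : Fin m → ℝ}
    (hμ : ∀ i, 0 < μ i) :
    m * ∑ i, μ i ^ (2 * q - 1) ≤ (∑ i, μ i ^ q) * ∑ i, μ i ^ (q - 1) := by
  have h : Antivary (fun i => μ i ^ q) (fun i => μ i ^ (q - 1)) := by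
    intro i j hij
    by_contra! hlt
    have h1 : μ i ≤ μ j := by
      by_contra! hc
      exact absurd (Real.rpow_le_rpow (hμ j).le hc.le hq0) (not_le.mpr hlt)
    exact absurd (Real.rpow_le_rpow_of_nonpos (hμ i) h1 (by linarith : q - 1 ≤ 0))
      (not_le.mpr hij)
  have := h.card_mul_sum_le_sum_mul_sum
  simp only [Fintype.card_fin] at this
  have e : ∀ i, μ i ^ (2 * q - 1) = μ i ^ q * μ i ^ (q - 1) := fun i => by
    rw [← Real.rpow_add (hμ i)]
    congr 1; ring
  simpa only [e] using this

-- Slopes of the concave function x^q decrease, so the row sums of the quotients are ordered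
-- oppositely to μ^q and Chebyshev applies. The resulting weighted double sum is symmetrised and
-- bounded pair by pair.
open Finset in
lemma card_mul_sum_rpow_le_sum_quotient {m : ℕ} {q : ℝ} (hq : 1 / 2 ≤ q) (hq1 : q ≤ 1)
    {μ : Fin m → ℝ} (hμ : ∀ i, 0 < μ i) (hinj : Function.Injective μ) :
    m * (q * (m - 1) * ∑ i, μ i ^ (2 * q - 1)) ≤
      (∑ i, μ i ^ q) * ∑ i, ∑ j, rpowQuotient q (μ i) (μ j) := by
  have hq0 : 0 ≤ q := by linarith
  have hself : ∀ x, rpowQuotient q x x = 0 := fun x => by simp [rpowQuotient]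
  have hanti : ∀ i j, μ i ≤ μ j →
      ∑ k, rpowQuotient q (μ j) (μ k) ≤ ∑ k, rpowQuotient q (μ i) (μ k) := by
    intro i j hij
    -- The swap matches the two vanishing diagonal terms and the two copies of the pair {i, j}; the
    -- remaining terms share their second argument and compare by concavity.
    rw [← Equiv.sum_comp (Equiv.swap i j) (fun k => rpowQuotient q (μ j) (μ k))]
    refine sum_le_sum fun k _ => ?_
    by_cases hki : k = i
    · subst hki; simp [hself]
    by_cases hkj : k = j
    · subst hkj; simp [rpowQuotient_comm]
    rw [Equiv.swap_apply_of_ne_of_ne hki hkj]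
    exact rpowQuotient_anti hq0 hq1 (hμ i).le hij (hμ k).le (hinj.ne (Ne.symm hki))
      (hinj.ne (Ne.symm hkj))
  have h : Antivary (fun i => μ i ^ q) (fun i => ∑ j, rpowQuotient q (μ i) (μ j)) := by
    intro i j hij
    rcases le_total (μ i) (μ j) with h1 | h1
    · exact absurd (hanti i j h1) (not_le.mpr hij)
    · exact Real.rpow_le_rpow (hμ j).le h1 hq0
  have hcheb := h.card_mul_sum_le_sum_mul_sum
  simp only [Fintype.card_fin] at hcheb
  refine le_trans (mul_le_mul_of_nonneg_left ?_ (Nat.cast_nonneg m)) hcheb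
  have h2 : 2 * ∑ i, μ i ^ q * ∑ j, rpowQuotient q (μ i) (μ j) =
      ∑ i, ∑ j, (μ i ^ q + μ j ^ q) * rpowQuotient q (μ i) (μ j) := by
    simp only [add_mul, sum_add_distrib, mul_sum]
    rw [sum_comm (f := fun i j => μ j ^ q * rpowQuotient q (μ i) (μ j))]
    simp only [rpowQuotient_comm q (μ _) (μ _)]
    simp only [← mul_sum]
    rw [two_mul]
  -- The subtracted term removes the diagonal, where the quotient is 0 by convention; hence the
  -- factor m - 1.
  have h3 : ∀ i j, q * (μ i ^ (2 * q - 1) + μ j ^ (2 * q - 1)) -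
      (if i = j then 2 * q * μ i ^ (2 * q - 1) else 0) ≤
      (μ i ^ q + μ j ^ q) * rpowQuotient q (μ i) (μ j) := by
    intro i j
    by_cases hij : i = j
    · subst hij; simp only [hself, if_true, mul_zero]; linarith
    · rw [if_neg hij, sub_zero]
      exact rpowQuotient_mul_add_ge hq hq1 (hμ i) (hμ j) (hinj.ne hij)
  have h4 := sum_le_sum fun i (_ : i ∈ univ) => sum_le_sum fun j (_ : j ∈ univ) => h3 i j
  rw [← h2] at h4
  simp only [sum_sub_distrib, ← mul_sum, sum_add_distrib, sum_const, card_univ, Fintype.card_fin,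
    nsmul_eq_mul, sum_ite_eq, mem_univ, if_true] at h4
  linarith

/-- The inequality between power sums behind the superharmonicity of the Schatten priors. -/
lemma powerSum_inequality {n m : ℕ} (hmn : m ≤ n) {p α : ℝ} (hα : 0 ≤ α)
    (h : (1 ≤ p ∧ p ≤ 2 ∧
            α ≤ (n : ℝ) * (m : ℝ) - (1 - p / 2) * (m : ℝ) * ((m : ℝ) + 1) - p) ∨
         (0 < p ∧ p < 1 ∧
            α ≤ (n : ℝ) * (m : ℝ) - (m : ℝ) * ((m : ℝ) + 1) + ((m : ℝ) - 1) * p))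
    {μ : Fin m → ℝ} (hμ : ∀ i, 0 < μ i) (hinj : Function.Injective μ) :
    (α + p) * ∑ i, μ i ^ (p - 1) ≤ (∑ i, μ i ^ (p / 2)) *
      ((p - 1 + n - m) * ∑ i, μ i ^ (p / 2 - 1) +
        ∑ i, ∑ j, rpowQuotient (p / 2) (μ i) (μ j)) := by
  have hnm : (m : ℝ) ≤ n := by exact_mod_cast hmn
  have hW : 0 ≤ ∑ i, μ i ^ (p - 1) := Finset.sum_nonneg fun i _ => (Real.rpow_pos_of_pos (hμ i) _).le
  have hG : 0 ≤ ∑ i, μ i ^ (p / 2) := Finset.sum_nonneg fun i _ => (Real.rpow_pos_of_pos (hμ i) _).le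
  rcases h with ⟨h1, h2, h3⟩ | ⟨h1, h2, h3⟩
  -- The two Chebyshev bounds add up to the constant m (p - 1 + n - m) + m (m - 1) p / 2 = n m - (1
  -- - p/2) m (m + 1).
  · have c1 := card_mul_sum_rpow_le (q := p / 2) (by linarith) (by linarith) hμ
    have c2 := card_mul_sum_rpow_le_sum_quotient (q := p / 2) (by linarith) (by linarith) hμ hinj
    rw [mul_div_cancel₀ p two_ne_zero] at c1 c2
    have c3 := mul_le_mul_of_nonneg_left c1 (by linarith : 0 ≤ p - 1 + n - m)
    have c4 := mul_le_mul_of_nonneg_right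
      (by linarith : α + p ≤ n * m - (1 - p / 2) * m * (m + 1)) hW
    nlinarith
  · have c1 := card_mul_sum_rpow_le (q := p / 2) (by linarith) (by linarith) hμ
    rw [mul_div_cancel₀ p two_ne_zero] at c1
    have c0 : α + p ≤ m * (p - 1 + n - m) := by linarith
    -- Positivity of α + p forces this factor to be positive, as needed to multiply the Chebyshev
    -- bound by it.
    have cpos : 0 < p - 1 + (n : ℝ) - m := by
      by_contra! hc
      have := mul_nonpos_of_nonneg_of_nonpos (Nat.cast_nonneg (α := ℝ) m) hc
      linarith
    have c3 := mul_le_mul_of_nonneg_left c1 cpos.le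
    have c4 := mul_le_mul_of_nonneg_right c0 hW
    have c5 : 0 ≤ (∑ i, μ i ^ (p / 2)) * ∑ i, ∑ j, rpowQuotient (p / 2) (μ i) (μ j) :=
      mul_nonneg hG (Finset.sum_nonneg fun i _ => Finset.sum_nonneg fun j _ =>
        rpowQuotient_nonneg (by linarith) (hμ i).le (hμ j).le)
    nlinarith

/-! ### The regularised prior and the sign of its Laplacian -/

/-- The regularisation `(∑ (σᵢ² + ε) ^ (p / 2)) ^ (-α / p)` of the Schatten prior. -/
noncomputable def regularizedPrior {n m : ℕ} (ε p α : ℝ) (M : MatrixSpace n m) : ℝ :=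
  spectralPowerSum ε (p / 2) M.toMatrix ^ (-(α / p))

lemma isBiorthogonallyInvariant_regularizedPrior {n m : ℕ} (ε p α : ℝ) :
    IsBiorthogonallyInvariant (regularizedPrior (n := n) (m := m) ε p α) := by
  intro U V M N hU hV hN
  rw [regularizedPrior, regularizedPrior, hN, spectralPowerSum, spectralPowerSum,
    sum_singularValue_sq_mul_mul M.toMatrix hU hV fun x => (x + ε) ^ (p / 2)]

lemma contDiffAt_regularizedPrior {n m : ℕ} (hm : 0 < m) {ε p α : ℝ} {M : MatrixSpace n m}
    (hM : ∀ i, 0 < matrixSingularValue M.toMatrix i ^ 2 + ε) {k : WithTop ℕ∞} :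
    ContDiffAt ℝ k (regularizedPrior ε p α) M := by
  have : Nonempty (Fin m) := ⟨⟨0, hm⟩⟩
  refine (contDiffAt_spectralPowerSum hM).rpow_const_of_ne ?_
  exact (Finset.sum_pos (fun i _ => Real.rpow_pos_of_pos (hM i) _) Finset.univ_nonempty).ne'

/-- Write (z + ε)^q = z (z + ε)^(q-1) + ε (z + ε)^(q-1); the last summand is nonincreasing in z and
contributes a nonpositive slope. The right-hand side is the form in which the Laplacian presents the
pair terms. -/
lemma rpowQuotient_le_shifted {q ε x y : ℝ} (hq : q ≤ 1) (hε : 0 ≤ ε) (hx : 0 < x) (hy : 0 < y) :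
    rpowQuotient q (x + ε) (y + ε) ≤
      (x * (x + ε) ^ (q - 1) - y * (y + ε) ^ (q - 1)) / (x - y) := by
  wlog h : y ≤ x generalizing x y
  · rw [rpowQuotient_comm, ← neg_div_neg_eq, neg_sub, neg_sub]
    exact this hy hx (le_of_not_ge h)
  have e : ∀ z, 0 < z → (z + ε) ^ q = (z + ε) ^ (q - 1) * (z + ε) := fun z hz => by
    rw [← Real.rpow_add_one (by positivity), sub_add_cancel]
  rw [rpowQuotient, add_sub_add_right_eq_sub]
  refine div_le_div_of_nonneg_right ?_ (sub_nonneg.mpr h)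
  rw [e x hx, e y hy]
  have := Real.rpow_le_rpow_of_nonpos (by positivity : 0 < y + ε) (by linarith : y + ε ≤ x + ε)
    (by linarith : q - 1 ≤ 0)
  nlinarith

/-- Here `x` plays the role of the singular value that moves and `c` that of the contribution of all
the others. -/
lemma hasDerivAt_shifted_power {x ε q β c t : ℝ} (hμ : 0 < (x + t) ^ 2 + ε)
    (hG : 0 < c + ((x + t) ^ 2 + ε) ^ q) :
    HasDerivAt (fun t => (c + ((x + t) ^ 2 + ε) ^ q) ^ (-β))
      (2 * (x + t) * q * ((x + t) ^ 2 + ε) ^ (q - 1) * -β *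
        (c + ((x + t) ^ 2 + ε) ^ q) ^ (-β - 1)) t := by
  have h0 : HasDerivAt (fun t => (x + t) ^ 2 + ε) (2 * (x + t)) t := by
    simpa using (((hasDerivAt_id t).const_add x).fun_pow 2).add_const ε
  exact ((h0.rpow_const (p := q) (Or.inl hμ.ne')).const_add c).rpow_const (Or.inl hG.ne')

lemma hasDerivAt_shifted_power_deriv {x ε q β c : ℝ} (hμ : 0 < x ^ 2 + ε)
    (hG : 0 < c + (x ^ 2 + ε) ^ q) :
    HasDerivAt (fun t => 2 * (x + t) * q * ((x + t) ^ 2 + ε) ^ (q - 1) * -β *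
        (c + ((x + t) ^ 2 + ε) ^ q) ^ (-β - 1))
      (β * (β + 1) * (c + (x ^ 2 + ε) ^ q) ^ (-β - 1 - 1) *
          (4 * q ^ 2 * (x ^ 2 * (x ^ 2 + ε) ^ (q - 1) * (x ^ 2 + ε) ^ (q - 1))) -
        β * (c + (x ^ 2 + ε) ^ q) ^ (-β - 1) *
          (2 * q * (x ^ 2 + ε) ^ (q - 1) + 4 * q * (q - 1) * (x ^ 2 * (x ^ 2 + ε) ^ (q - 1 - 1)))) 0 := by
  have h0 : HasDerivAt (fun t => (x + t) ^ 2 + ε) (2 * x) 0 := by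
    simpa using (((hasDerivAt_id (0 : ℝ)).const_add x).fun_pow 2).add_const ε
  have hμ' : (x + 0) ^ 2 + ε ≠ 0 := by simpa using hμ.ne'
  have hG' : c + ((x + 0) ^ 2 + ε) ^ q ≠ 0 := by simpa using hG.ne'
  have h1 := h0.rpow_const (p := q - 1) (Or.inl hμ')
  have h2 := ((h0.rpow_const (p := q) (Or.inl hμ')).const_add c).rpow_const (p := -β - 1)
    (Or.inl hG')
  have h3 := ((((hasDerivAt_id (0 : ℝ)).const_add x).const_mul 2).mul_const q).fun_mul h1
  have h4 := (h3.mul_const (-β)).fun_mul h2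
  refine h4.congr_deriv ?_
  simp only [add_zero, id]
  ring

section
variable {n m : ℕ} {ε p α : ℝ}

lemma spectralPowerSum_rectDiagonal (hmn : m ≤ n) (s : Fin m → ℝ) (q : ℝ) :
    spectralPowerSum ε q (rectDiagonal n s) = ∑ i, (s i ^ 2 + ε) ^ q :=
  sum_singularValue_sq_rectDiagonal hmn s fun x => (x + ε) ^ q

lemma regularizedPrior_derivatives (hmn : m ≤ n) (hε : 0 ≤ ε) {D : MatrixSpace n m} {s : Fin m → ℝ}
    (hD : D.toMatrix = rectDiagonal n s) (hs : ∀ a, 0 < s a)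
    (hh : ContDiffAt ℝ 2 (regularizedPrior ε p α) D) (a : Fin m) {G : ℝ}
    (hG : G = ∑ i, (s i ^ 2 + ε) ^ (p / 2)) :
    fderiv ℝ (regularizedPrior ε p α) D (EuclideanSpace.single (Fin.castLE hmn a, a) (1 : ℝ)) =
        2 * s a * (p / 2) * (s a ^ 2 + ε) ^ (p / 2 - 1) * -(α / p) * G ^ (-(α / p) - 1) ∧
      iteratedFDeriv ℝ 2 (regularizedPrior ε p α) D
          ![EuclideanSpace.single (Fin.castLE hmn a, a) (1 : ℝ),
            EuclideanSpace.single (Fin.castLE hmn a, a) (1 : ℝ)] =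
        (α / p) * (α / p + 1) * G ^ (-(α / p) - 1 - 1) * (4 * (p / 2) ^ 2 *
          (s a ^ 2 * (s a ^ 2 + ε) ^ (p / 2 - 1) * (s a ^ 2 + ε) ^ (p / 2 - 1))) -
        (α / p) * G ^ (-(α / p) - 1) * (2 * (p / 2) * (s a ^ 2 + ε) ^ (p / 2 - 1) +
          4 * (p / 2) * (p / 2 - 1) * (s a ^ 2 * (s a ^ 2 + ε) ^ (p / 2 - 1 - 1))) := by
  set c : ℝ := ∑ i ∈ Finset.univ.erase a, (s i ^ 2 + ε) ^ (p / 2) with hc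
  have hc0 : 0 ≤ c := Finset.sum_nonneg fun i _ => by positivity
  have hGc : G = c + (s a ^ 2 + ε) ^ (p / 2) := by
    rw [hG, hc, add_comm, Finset.add_sum_erase _ (fun i => (s i ^ 2 + ε) ^ (p / 2)) (Finset.mem_univ a)]
  have hpos : ∀ t : ℝ, 0 < s a + t →
      0 < (s a + t) ^ 2 + ε ∧ 0 < c + ((s a + t) ^ 2 + ε) ^ (p / 2) := by
    intro t ht
    have : 0 < (s a + t) ^ 2 + ε := by positivity
    exact ⟨this, by have := Real.rpow_pos_of_pos this (p / 2); linarith⟩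
  have hev : ∀ᶠ t in nhds (0 : ℝ), 0 < s a + t := by
    have : Filter.Tendsto (fun t : ℝ => s a + t) (nhds 0) (nhds (s a + 0)) :=
      (continuous_const.add continuous_id).continuousAt
    rw [add_zero] at this
    exact this.eventually_const_lt (hs a)
  have hline := iteratedFDeriv_two_line (f := regularizedPrior ε p α) (x := D)
    (A := EuclideanSpace.single (Fin.castLE hmn a, a) (1 : ℝ)) hh
    (κ := fun t => (c + ((s a + t) ^ 2 + ε) ^ (p / 2)) ^ (-(α / p)))
    (by
      intro t
      rw [regularizedPrior]
      congr 1
      rw [MatrixSpace.toMatrix_add, MatrixSpace.toMatrix_smul, MatrixSpace.toMatrix_single, hD,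
        rectDiagonal_add_single hmn, spectralPowerSum_rectDiagonal hmn,
        ← Finset.add_sum_erase _ _ (Finset.mem_univ a), add_comm, hc]
      congr 1
      · refine Finset.sum_congr rfl fun i hi => ?_
        rw [Function.update_of_ne (Finset.ne_of_mem_erase hi)]
      · simp)
    (hev.mono fun t ht => hasDerivAt_shifted_power (hpos t ht).1 (hpos t ht).2)
    (hasDerivAt_shifted_power_deriv (by simpa using (hpos 0 (by simpa using hs a)).1)
      (by simpa using (hpos 0 (by simpa using hs a)).2))
  simpa only [hGc, add_zero] using hline

/-- The regularised prior has nonpositive Laplacian at diagonal matrices with distinct positive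
diagonal entries. -/
lemma matrixLaplacian_regularizedPrior_rectDiagonal_nonpos (hmn : m ≤ n) (hε : 0 ≤ ε) (hα : 0 ≤ α)
    (h : (1 ≤ p ∧ p ≤ 2 ∧
            α ≤ (n : ℝ) * (m : ℝ) - (1 - p / 2) * (m : ℝ) * ((m : ℝ) + 1) - p) ∨
         (0 < p ∧ p < 1 ∧
            α ≤ (n : ℝ) * (m : ℝ) - (m : ℝ) * ((m : ℝ) + 1) + ((m : ℝ) - 1) * p))
    {D : MatrixSpace n m} {s : Fin m → ℝ}
    (hD : D.toMatrix = rectDiagonal n s) (hs : ∀ a, 0 < s a) (hinj : Function.Injective s)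
    (hh : ContDiffAt ℝ 2 (regularizedPrior ε p α) D) :
    matrixLaplacian (regularizedPrior ε p α) D ≤ 0 := by
  have hp : 0 < p := by rcases h with h | h <;> linarith [h.1]
  have hp2 : p ≤ 2 := by rcases h with h | h <;> linarith [h.2.1]
  set μ : Fin m → ℝ := fun a => s a ^ 2 + ε with hμdef
  have hμ : ∀ a, 0 < μ a := fun a => by have := hs a; positivity
  have hμinj : Function.Injective μ := by
    intro a b hab
    have : s a ^ 2 = s b ^ 2 := by simpa [hμdef] using hab
    exact hinj ((pow_left_inj₀ (hs a).le (hs b).le two_ne_zero).mp this)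
  have hineq := powerSum_inequality hmn hα h hμ hμinj
  set q := p / 2 with hq
  set β := α / p with hβ
  have hβ0 : 0 ≤ β := div_nonneg hα hp.le
  set G := ∑ i, μ i ^ q with hG
  have hd := fun a => regularizedPrior_derivatives (α := α) hmn hε hD hs hh a hG
  rw [matrixLaplacian_eq_of_rectDiagonal hmn
    (isBiorthogonallyInvariant_regularizedPrior ε p α) hD hh hs hinj]
  simp only [fun a => (hd a).1, fun a => (hd a).2]
  rw [← hq, ← hβ]
  rcases isEmpty_or_nonempty (Fin m) with he | he
  · simp
  have hG0 : 0 < G := Finset.sum_pos (fun i _ => Real.rpow_pos_of_pos (hμ i) _) Finset.univ_nonempty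
  -- The lowest power of G is factored out, so that the second-order and first-order terms differ by
  -- one factor G.
  set A := G ^ (-β - 1 - 1) with hA
  have hA0 : 0 < A := Real.rpow_pos_of_pos hG0 _
  have hAG : G ^ (-β - 1) = A * G := by
    rw [hA, ← Real.rpow_add_one hG0.ne', sub_add_cancel]
  rw [hAG]
  have hq0 : 0 < q := by positivity
  have hq1 : q ≤ 1 := by rw [hq]; linarith
  have e1 : ∀ a, μ a ^ (p - 1) = μ a * μ a ^ (q - 1) * μ a ^ (q - 1) := fun a => by
    rw [mul_comm (μ a), ← Real.rpow_add_one (hμ a).ne', ← Real.rpow_add (hμ a)]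
    congr 1; rw [hq]; ring
  have e2 : ∀ a, μ a ^ (q - 1) = μ a * μ a ^ (q - 1 - 1) := fun a => by
    rw [mul_comm (μ a), ← Real.rpow_add_one (hμ a).ne', sub_add_cancel]
  have hsμ : ∀ a, s a ^ 2 ≤ μ a := fun a => by simp [hμdef, hε]
  -- Both occurrences of s_a² have nonnegative coefficients (the second because q ≤ 1), so s_a² may
  -- be replaced by the larger μ_a; then 2q + 4q(q - 1) = 2q(p - 1).
  have t1 : ∀ a, β * (β + 1) * A * (4 * q ^ 2 *
        (s a ^ 2 * μ a ^ (q - 1) * μ a ^ (q - 1))) - β * (A * G) * (2 * q * μ a ^ (q - 1) +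
          4 * q * (q - 1) * (s a ^ 2 * μ a ^ (q - 1 - 1))) ≤
      β * A * (2 * q) * ((β + 1) * (2 * q) * μ a ^ (p - 1) -
        G * ((p - 1) * μ a ^ (q - 1))) := by
    intro a
    have w0 := Real.rpow_pos_of_pos (hμ a) (q - 1)
    have b1 : s a ^ 2 * μ a ^ (q - 1) * μ a ^ (q - 1) ≤ μ a ^ (p - 1) := by
      rw [e1]; gcongr; exact hsμ a
    have b2 : s a ^ 2 * μ a ^ (q - 1 - 1) ≤ μ a ^ (q - 1) := by
      conv_rhs => rw [e2]
      gcongr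
      exact hsμ a
    have c1 := mul_le_mul_of_nonneg_left b1 (by positivity : 0 ≤ β * (β + 1) * A * (4 * q ^ 2))
    have c2 := mul_le_mul_of_nonneg_left b2
      (mul_nonneg (by positivity : 0 ≤ β * (A * G) * (4 * q)) (sub_nonneg.mpr hq1))
    have hp' : p = 2 * q := by rw [hq]; ring
    rw [show (p - 1) * μ a ^ (q - 1) = (2 * q - 1) * μ a ^ (q - 1) by rw [← hp']]
    linarith
  have t2 : ∀ a, 2 * s a * q * μ a ^ (q - 1) * -β * (A * G) / s a =
      β * A * (2 * q) * (-G * μ a ^ (q - 1)) := by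
    intro a
    have := (hs a).ne'
    field_simp
  have t3 : ∀ a b, (s a * (2 * s a * q * μ a ^ (q - 1) * -β * (A * G)) -
      s b * (2 * s b * q * μ b ^ (q - 1) * -β * (A * G))) / (s a ^ 2 - s b ^ 2) ≤
      β * A * (2 * q) * (-G * rpowQuotient q (μ a) (μ b)) := by
    intro a b
    have hx := rpowQuotient_le_shifted hq1 hε (pow_pos (hs a) 2) (pow_pos (hs b) 2)
    have c := mul_le_mul_of_nonneg_left hx (by positivity : 0 ≤ β * A * (2 * q) * G)
    have e : (s a * (2 * s a * q * μ a ^ (q - 1) * -β * (A * G)) -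
      s b * (2 * s b * q * μ b ^ (q - 1) * -β * (A * G))) / (s a ^ 2 - s b ^ 2) =
      -(β * A * (2 * q) * G * ((s a ^ 2 * (s a ^ 2 + ε) ^ (q - 1) -
        s b ^ 2 * (s b ^ 2 + ε) ^ (q - 1)) / (s a ^ 2 - s b ^ 2))) := by
      simp only [hμdef]
      rw [mul_div_assoc', ← neg_div]
      ring
    rw [e]
    simp only [hμdef]
    linarith
  have hn : (0 : ℝ) ≤ (n : ℝ) - m := sub_nonneg.mpr (by exact_mod_cast hmn)
  have s1 := Finset.sum_le_sum fun a (_ : a ∈ Finset.univ) => t1 a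
  have s3 := Finset.sum_le_sum fun a (_ : a ∈ Finset.univ) =>
    Finset.sum_le_sum fun b (_ : b ∈ Finset.univ) => t3 a b
  rw [Finset.sum_congr rfl fun a _ => t2 a]
  refine (add_le_add (add_le_add s1 le_rfl) s3).trans ?_
  simp only [← Finset.mul_sum, Finset.sum_sub_distrib]
  -- This is the source of the constant α + p in the power sum inequality.
  have hβp : (β + 1) * (2 * q) = α + p := by
    rw [hβ, hq]; field_simp
  rw [hβp]
  have hfin := mul_le_mul_of_nonneg_left hineq (by positivity : 0 ≤ β * A * (2 * q))
  linarith
end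

/-! ### From diagonal to arbitrary matrices -/

section

open Matrix

lemma matrixLaplacian_eq_laplacian {n m : ℕ} (f : MatrixSpace n m → ℝ) (M : MatrixSpace n m) :
    matrixLaplacian f M = Laplacian.laplacian f M := by
  rw [laplacian_eq_iteratedFDeriv_orthonormalBasis f (EuclideanSpace.basisFun (Fin n × Fin m) ℝ),
    matrixLaplacian]
  simp [Fintype.sum_prod_type]

lemma MatrixSpace.norm_sq_eq_trace {n m : ℕ} (M : MatrixSpace n m) :
    ‖M‖ ^ 2 = (M.toMatrixᵀ * M.toMatrix).trace := by
  rw [EuclideanSpace.norm_sq_eq, Fintype.sum_prod_type, Finset.sum_comm]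
  simp [trace, mul_apply, MatrixSpace.toMatrix, sq]

/-- Multiplication by orthogonal matrices on both sides is a linear isometry. -/
lemma exists_orthogonal_linearIsometryEquiv {n m : ℕ} {U : Matrix (Fin n) (Fin n) ℝ}
    {V : Matrix (Fin m) (Fin m) ℝ} (hU : Uᵀ * U = 1) (hV : Vᵀ * V = 1) :
    ∃ Φ : MatrixSpace n m ≃ₗᵢ[ℝ] MatrixSpace n m,
      ∀ M, (Φ M).toMatrix = U * M.toMatrix * V := by
  let φ : MatrixSpace n m →ₗ[ℝ] MatrixSpace n m :=
    { toFun := fun M => WithLp.toLp 2 fun x => (U * M.toMatrix * V) x.1 x.2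
      map_add' := by
        intro M N; ext x
        simp [Matrix.mul_add, Matrix.add_mul]
      map_smul' := by
        intro c M; ext x
        simp }
  have hφ : ∀ M, (φ M).toMatrix = U * M.toMatrix * V := fun M => by
    ext i j; simp [φ, MatrixSpace.toMatrix]
  have hV' : V * Vᵀ = 1 := mul_eq_one_comm.mp hV
  have hnorm : ∀ M, ‖φ M‖ = ‖M‖ := by
    intro M
    rw [← sq_eq_sq₀ (norm_nonneg _) (norm_nonneg _), MatrixSpace.norm_sq_eq_trace,
      MatrixSpace.norm_sq_eq_trace, hφ]
    calc ((U * M.toMatrix * V)ᵀ * (U * M.toMatrix * V)).trace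
        = (Vᵀ * (M.toMatrixᵀ * (Uᵀ * U) * M.toMatrix * V)).trace := by
          simp only [transpose_mul, Matrix.mul_assoc]
      _ = _ := by
          rw [trace_mul_comm, hU, Matrix.mul_one, Matrix.mul_assoc _ V, hV', Matrix.mul_one]
  exact ⟨LinearIsometry.toLinearIsometryEquiv ⟨φ, hnorm⟩ rfl, hφ⟩

/-- The Laplacian may be computed in any orthonormal basis, in particular in the image of the matrix
units under the isometry `Φ`, which leaves `h` unchanged. -/
lemma matrixLaplacian_eq_of_orthogonal {n m : ℕ} {h : MatrixSpace n m → ℝ}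
    (hinv : IsBiorthogonallyInvariant h) {U : Matrix (Fin n) (Fin n) ℝ}
    {V : Matrix (Fin m) (Fin m) ℝ} (hU : Uᵀ * U = 1) (hV : Vᵀ * V = 1) {M N : MatrixSpace n m}
    (hN : N.toMatrix = U * M.toMatrix * V) :
    matrixLaplacian h N = matrixLaplacian h M ∧ (ContDiffAt ℝ 2 h N → ContDiffAt ℝ 2 h M) := by
  obtain ⟨Φ, hΦ⟩ := exists_orthogonal_linearIsometryEquiv hU hV
  have hNΦ : N = Φ M := MatrixSpace.toMatrix_injective (by rw [hN, hΦ])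
  have hcomp : h ∘ Φ = h := funext fun X => hinv U V X (Φ X) hU hV (hΦ X)
  constructor
  · rw [matrixLaplacian_eq_laplacian, matrixLaplacian_eq_laplacian,
      congrFun (laplacian_eq_iteratedFDeriv_orthonormalBasis h
        ((EuclideanSpace.basisFun (Fin n × Fin m) ℝ).map Φ)) N,
      congrFun (laplacian_eq_iteratedFDeriv_orthonormalBasis h
        (EuclideanSpace.basisFun (Fin n × Fin m) ℝ)) M]
    refine Finset.sum_congr rfl fun i _ => ?_
    have := Φ.toContinuousLinearEquiv.iteratedFDerivWithin_comp_right h uniqueDiffOn_univ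
      (Set.mem_univ (Φ.toContinuousLinearEquiv M)) 2
    rw [Set.preimage_univ, iteratedFDerivWithin_univ, iteratedFDerivWithin_univ] at this
    have hc : h ∘ Φ.toContinuousLinearEquiv = h := hcomp
    rw [hc] at this
    rw [this, hNΦ]
    simp only [ContinuousMultilinearMap.compContinuousLinearMap_apply, OrthonormalBasis.map_apply]
    congr 1
    funext j
    fin_cases j <;> rfl
  · intro hc
    rw [← hcomp]
    rw [hNΦ] at hc
    exact hc.comp M Φ.toContinuousLinearEquiv.contDiff.contDiffAt

/-- The regularised prior has nonpositive Laplacian wherever it is `C²`. -/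
theorem matrixLaplacian_regularizedPrior_nonpos {n m : ℕ} {ε p α : ℝ} (hmn : m ≤ n) (hε : 0 ≤ ε)
    (hα : 0 ≤ α)
    (h : (1 ≤ p ∧ p ≤ 2 ∧
            α ≤ (n : ℝ) * (m : ℝ) - (1 - p / 2) * (m : ℝ) * ((m : ℝ) + 1) - p) ∨
         (0 < p ∧ p < 1 ∧
            α ≤ (n : ℝ) * (m : ℝ) - (m : ℝ) * ((m : ℝ) + 1) + ((m : ℝ) - 1) * p))
    {M : MatrixSpace n m} (hM : ContDiffAt ℝ 2 (regularizedPrior ε p α) M) :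
    matrixLaplacian (regularizedPrior ε p α) M ≤ 0 := by
  obtain ⟨U, V, hU, hV, hUV⟩ := exists_singularValue_decomposition hmn M.toMatrix
  set σ := matrixSingularValue M.toMatrix with hσ
  -- Moving along `K` adds t (m - i) to σᵢ. These increments are positive and strictly decreasing,
  -- like the order of the σᵢ, so for t > 0 the diagonal entries are positive and distinct.
  obtain ⟨K, hK⟩ := MatrixSpace.exists_toMatrix_eq
    (U * rectDiagonal n (fun i : Fin m => (m : ℝ) - i) * V)
  have hrect : ∀ t : ℝ, (M + t • K).toMatrix =
      U * rectDiagonal n (fun i => σ i + t * ((m : ℝ) - i)) * V := by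
    intro t
    have : rectDiagonal n (fun i => σ i + t * ((m : ℝ) - i)) =
        rectDiagonal n σ + t • rectDiagonal n (fun i : Fin m => (m : ℝ) - i) := by
      ext i j
      by_cases hij : (i : ℕ) = j <;> simp [rectDiagonal, hij]
    rw [MatrixSpace.toMatrix_add, MatrixSpace.toMatrix_smul, hK, hUV, this]
    simp [Matrix.mul_add, Matrix.add_mul]
  have hpath : Filter.Tendsto (fun t : ℝ => M + t • K) (nhdsWithin 0 (Set.Ioi 0)) (nhds M) := by
    have : Continuous fun t : ℝ => M + t • K := by fun_prop
    simpa using (this.tendsto 0).mono_left nhdsWithin_le_nhds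
  have hlap : ContinuousAt (matrixLaplacian (regularizedPrior ε p α)) M := by
    have h2 : ContinuousAt (fderiv ℝ (fderiv ℝ (regularizedPrior ε p α))) M :=
      ((hM.fderiv_right (m := 1) (by norm_num)).fderiv_right (m := 0) (by norm_num)).continuousAt
    unfold matrixLaplacian
    simp only [iteratedFDeriv_two_apply]
    refine tendsto_finsetSum _ fun i _ => tendsto_finsetSum _ fun j _ => ?_
    exact (h2.clm_apply continuousAt_const).clm_apply continuousAt_const
  refine le_of_tendsto (hlap.tendsto.comp hpath) ?_
  have hev : ∀ᶠ N in nhds M, ContDiffAt ℝ 2 (regularizedPrior ε p α) N := hM.eventually (by simp)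
  filter_upwards [hpath.eventually hev, self_mem_nhdsWithin] with t ht ht0
  rw [Set.mem_Ioi] at ht0
  obtain ⟨D, hD⟩ := MatrixSpace.exists_toMatrix_eq
    (rectDiagonal n (fun i => σ i + t * ((m : ℝ) - i)))
  have hND : (M + t • K).toMatrix = U * D.toMatrix * V := by rw [hD, hrect]
  have htr := matrixLaplacian_eq_of_orthogonal
    (isBiorthogonallyInvariant_regularizedPrior ε p α) hU hV hND
  simp only [Function.comp_apply]
  rw [htr.1]
  have hlt : ∀ i : Fin m, (0 : ℝ) < (m : ℝ) - i := fun i =>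
    sub_pos.mpr (by exact_mod_cast i.2)
  refine matrixLaplacian_regularizedPrior_rectDiagonal_nonpos hmn hε hα h hD (fun i => ?_) ?_
    (htr.2 ht)
  · have : 0 ≤ σ i := LinearMap.singularValues_nonneg _ _
    have := mul_pos ht0 (hlt i)
    linarith
  · refine StrictAnti.injective fun i j hij => ?_
    have h1 : σ j ≤ σ i := LinearMap.singularValues_antitone _ (by exact_mod_cast hij.le)
    have h2 : ((i : ℕ) : ℝ) < j := by exact_mod_cast hij
    have := mul_lt_mul_of_pos_left h2 ht0

    linarith

end

/-! ### Spherical means and the mean value inequality -/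

section
variable {E : Type*} [NormedAddCommGroup E] [InnerProductSpace ℝ E] [FiniteDimensional ℝ E]
  [MeasurableSpace E] [BorelSpace E]

open scoped Pointwise in
/-- The surface measure on the unit sphere is invariant under linear isometries. -/
lemma integral_toSphere_comp_linearIsometryEquiv (Φ : E ≃ₗᵢ[ℝ] E) (f : E → ℝ) :
    ∫ ω : Metric.sphere (0 : E) 1, f (Φ ω) ∂(volume : Measure E).toSphere =
      ∫ ω : Metric.sphere (0 : E) 1, f ω ∂(volume : Measure E).toSphere := by
  let T : Metric.sphere (0 : E) 1 ≃ₜ Metric.sphere (0 : E) 1 :=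
    Φ.toHomeomorph.subtype fun x => by simp
  have hT : ∀ ω, ((T ω : Metric.sphere (0 : E) 1) : E) = Φ ω := fun ω => rfl
  have hmp : MeasurePreserving T (volume : Measure E).toSphere (volume : Measure E).toSphere := by
    refine ⟨T.continuous.measurable, ?_⟩
    ext s hs
    rw [Measure.map_apply T.continuous.measurable hs,
      Measure.toSphere_apply' _ (T.continuous.measurable hs), Measure.toSphere_apply' _ hs]
    congr 1
    -- The surface measure of a set is a multiple of the volume of the cone over it; `Φ` maps cones
    -- to cones and preserves volume.
    have : Set.Ioo (0 : ℝ) 1 • ((↑) '' (T ⁻¹' s) : Set E) =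
        Φ ⁻¹' (Set.Ioo (0 : ℝ) 1 • ((↑) '' s)) := by
      ext x
      simp only [Set.mem_smul, Set.mem_preimage, Set.mem_image]
      constructor
      · rintro ⟨c, hc, y, ⟨ω, hω, rfl⟩, rfl⟩
        exact ⟨c, hc, _, ⟨T ω, hω, rfl⟩, by rw [hT, map_smul]⟩
      · rintro ⟨c, hc, y, ⟨ω, hω, rfl⟩, hx⟩
        refine ⟨c, hc, _, ⟨T.symm ω, by simpa using hω, rfl⟩, ?_⟩
        apply Φ.injective
        rw [map_smul, ← hT, T.apply_symm_apply, hx]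
    rw [this]
    exact Φ.measurePreserving.measure_preimage_equiv (f := Φ.toHomeomorph.toMeasurableEquiv) _
  exact hmp.integral_comp T.measurableEmbedding (fun ω => f ω)

lemma hasDerivAt_integral_of_continuous {X : Type*} [TopologicalSpace X] [CompactSpace X]
    [MeasurableSpace X] [BorelSpace X] {μ : Measure X} [IsFiniteMeasure μ] {F F' : ℝ → X → ℝ}
    (hF : ∀ t, Continuous (F t)) (hF' : Continuous fun z : ℝ × X => F' z.1 z.2)
    (h : ∀ t a, HasDerivAt (fun t => F t a) (F' t a) t) (t₀ : ℝ) :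
    HasDerivAt (fun t => ∫ a, F t a ∂μ) (∫ a, F' t₀ a ∂μ) t₀ := by
  have hc : IsCompact (Set.Icc (t₀ - 1) (t₀ + 1) ×ˢ (Set.univ : Set X)) :=
    isCompact_Icc.prod isCompact_univ
  obtain ⟨C, hC⟩ := hc.exists_bound_of_continuousOn hF'.continuousOn
  have hint : ∀ t, Integrable (F t) μ := fun t =>
    (hF t).integrable_of_hasCompactSupport (HasCompactSupport.of_compactSpace _)
  refine (hasDerivAt_integral_of_dominated_loc_of_deriv_le (bound := fun _ => C)
    (Icc_mem_nhds (by linarith : t₀ - 1 < t₀) (by linarith : t₀ < t₀ + 1))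
    (Filter.Eventually.of_forall fun t => (hint t).aestronglyMeasurable) (hint t₀) ?_ ?_
    (integrable_const C) ?_).2
  · exact (hF'.comp (by fun_prop : Continuous fun a : X => (t₀, a))).aestronglyMeasurable
  · exact Filter.Eventually.of_forall fun a t ht => hC (t, a) ⟨ht, Set.mem_univ _⟩
  · exact Filter.Eventually.of_forall fun a t _ => h t a

end

section
variable {E : Type*} [NormedAddCommGroup E] [InnerProductSpace ℝ E]

/-- The infinitesimal rotation in the plane of `u` and `v`. -/
noncomputable def planeSkew (u v : E) : E →L[ℝ] E :=
  (innerSL ℝ u).smulRight v - (innerSL ℝ v).smulRight u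

lemma planeSkew_apply (u v x : E) : planeSkew u v x = inner ℝ u x • v - inner ℝ v x • u := by
  simp [planeSkew]

lemma inner_planeSkew (u v x y : E) :
    inner ℝ (planeSkew u v x) y = -inner ℝ x (planeSkew u v y) := by
  simp only [planeSkew_apply, inner_sub_left, inner_sub_right, inner_smul_left, inner_smul_right,
    conj_trivial, real_inner_comm x]
  ring

/-- For i = j the operator is zero, and the conditional term cancels the projections; sums may then
run over all ordered pairs. -/
lemma planeSkew_planeSkew {ι : Type*} [Fintype ι] [DecidableEq ι] (b : OrthonormalBasis ι ℝ E)
    (i j : ι) (x : E) :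
    planeSkew (b i) (b j) (planeSkew (b i) (b j) x) =
      (if i = j then (2 * inner ℝ (b i) x) • b i else 0) -
        (inner ℝ (b i) x • b i + inner ℝ (b j) x • b j) := by
  have h := orthonormal_iff_ite.mp b.orthonormal
  by_cases hij : i = j
  · subst hij
    simp only [planeSkew_apply, sub_self, inner_zero_right, zero_smul, if_true]
    module
  · simp only [planeSkew_apply, inner_sub_right, inner_smul_right, h, if_neg hij,
      if_neg (Ne.symm hij), if_true]
    module

/-- For i ≠ j the operator is a quarter turn in a plane and zero on its orthogonal complement. -/
lemma planeSkew_cube {ι : Type*} [Fintype ι] (b : OrthonormalBasis ι ℝ E)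
    (i j : ι) (x : E) :
    planeSkew (b i) (b j) (planeSkew (b i) (b j) (planeSkew (b i) (b j) x)) =
      -planeSkew (b i) (b j) x := by
  classical
  have h := orthonormal_iff_ite.mp b.orthonormal
  by_cases hij : i = j
  · subst hij
    simp [planeSkew_apply]
  · simp only [planeSkew_apply, inner_sub_right, inner_smul_right, h, if_neg hij,
      if_neg (Ne.symm hij), if_true]
    module

/-- This is exp(tJ): the exponential series collapses to Rodrigues' formula because J³ = -J, and
skewness makes it an isometry. -/
lemma exists_rotation [FiniteDimensional ℝ E] {J : E →L[ℝ] E} (hJ : ∀ x y, inner ℝ (J x) y = -inner ℝ x (J y))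
    (hJ3 : ∀ x, J (J (J x)) = -J x) (t : ℝ) :
    ∃ Φ : E ≃ₗᵢ[ℝ] E, ∀ x, Φ x = x + Real.sin t • J x + (1 - Real.cos t) • J (J x) := by
  let φ : E →L[ℝ] E :=
    ContinuousLinearMap.id ℝ E + Real.sin t • J + (1 - Real.cos t) • (J.comp J)
  have hφ : ∀ x, φ x = x + Real.sin t • J x + (1 - Real.cos t) • J (J x) := fun x => by simp [φ]
  have hnorm : ∀ x, ‖φ x‖ = ‖x‖ := by
    intro x
    rw [← sq_eq_sq₀ (norm_nonneg _) (norm_nonneg _), ← real_inner_self_eq_norm_sq,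
      ← real_inner_self_eq_norm_sq, hφ]
    have h0 : ∀ y, inner ℝ y (J y) = 0 := fun y => by
      have := hJ y y
      rw [real_inner_comm] at this
      linarith
    have h1 : inner ℝ x (J (J x)) = -inner ℝ (J x) (J x) := by rw [hJ]; ring
    have h2 : inner ℝ (J (J x)) (J (J x)) = inner ℝ (J x) (J x) := by
      rw [hJ, hJ3, inner_neg_right, neg_neg]
    have h3 := Real.sin_sq_add_cos_sq t
    simp only [inner_add_left, inner_add_right, inner_smul_left, inner_smul_right, conj_trivial,
      real_inner_comm x, real_inner_comm (J x) (J (J x)), h0, h1, h2]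
    linear_combination (inner ℝ (J x) (J x)) * h3
  exact ⟨LinearIsometry.toLinearIsometryEquiv ⟨φ.toLinearMap, hnorm⟩ rfl, hφ⟩

/-- With `B` a Hessian, the sum over all planes of rotation leaves the trace minus the radial part,
each plane being counted twice. -/
lemma sum_bilinear_planeSkew {ι : Type*} [Fintype ι] (b : OrthonormalBasis ι ℝ E)
    (B : E →L[ℝ] E →L[ℝ] ℝ) (x : E) :
    ∑ i, ∑ j, B (planeSkew (b i) (b j) x) (planeSkew (b i) (b j) x) =
      2 * (‖x‖ ^ 2 * ∑ i, B (b i) (b i) - B x x) := by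
  have hx : B x x = ∑ i, ∑ j, inner ℝ (b i) x * inner ℝ (b j) x * B (b j) (b i) := by
    conv_lhs => rw [← b.sum_repr' x]
    simp only [map_sum, map_smul, _root_.sum_apply, _root_.smul_apply, smul_eq_mul, Finset.mul_sum]
    refine Finset.sum_congr rfl fun i _ => Finset.sum_congr rfl fun j _ => ?_
    ring
  have hn : ‖x‖ ^ 2 = ∑ i, inner ℝ (b i) x * inner ℝ (b i) x := by
    rw [← b.sum_sq_norm_inner_right x]
    exact Finset.sum_congr rfl fun i _ => by rw [Real.norm_eq_abs, sq_abs, sq]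
  have hterm : ∀ i j, B (planeSkew (b i) (b j) x) (planeSkew (b i) (b j) x) =
      inner ℝ (b i) x * inner ℝ (b i) x * B (b j) (b j) +
      inner ℝ (b j) x * inner ℝ (b j) x * B (b i) (b i) -
      inner ℝ (b i) x * inner ℝ (b j) x * B (b j) (b i) -
      inner ℝ (b j) x * inner ℝ (b i) x * B (b i) (b j) := by
    intro i j
    simp only [planeSkew_apply, map_sub, map_smul, _root_.sub_apply, _root_.smul_apply, smul_eq_mul]
    ring
  simp only [hterm, Finset.sum_sub_distrib, Finset.sum_add_distrib]
  rw [Finset.sum_comm (f := fun i j => inner ℝ (b j) x * inner ℝ (b j) x * B (b i) (b i)),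
    Finset.sum_comm (f := fun i j => inner ℝ (b j) x * inner ℝ (b i) x * B (b i) (b j)),
    ← hx, hn, Finset.sum_mul_sum]
  ring

lemma sum_planeSkew_planeSkew {ι : Type*} [Fintype ι] (b : OrthonormalBasis ι ℝ E) (x : E) :
    ∑ i, ∑ j, planeSkew (b i) (b j) (planeSkew (b i) (b j) x) =
      -(2 * ((Fintype.card ι : ℝ) - 1)) • x := by
  classical
  simp only [planeSkew_planeSkew, Finset.sum_sub_distrib, Finset.sum_add_distrib, Finset.sum_ite_eq,
    Finset.mem_univ, if_true, Finset.sum_const, Finset.card_univ, mul_smul, ← Finset.smul_sum,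
    b.sum_repr' x]
  rw [← Nat.cast_smul_eq_nsmul ℝ]
  module

end

section
variable {E : Type*} [NormedAddCommGroup E] [InnerProductSpace ℝ E] [FiniteDimensional ℝ E]
  [MeasurableSpace E] [BorelSpace E]

lemma integrable_toSphere {g : Metric.sphere (0 : E) 1 → ℝ} (hg : Continuous g) :
    Integrable g (volume : Measure E).toSphere :=
  hg.integrable_of_hasCompactSupport (HasCompactSupport.of_compactSpace _)

/-- The infinitesimal form of the rotation invariance of spherical integrals. -/
lemma integral_toSphere_skew_eq_zero {f : E → ℝ} (hf : ContDiff ℝ 2 f) {J : E →L[ℝ] E}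
    (hJ : ∀ x y, inner ℝ (J x) y = -inner ℝ x (J y)) (hJ3 : ∀ x, J (J (J x)) = -J x)
    (x : E) (r : ℝ) :
    ∫ ω : Metric.sphere (0 : E) 1, (r ^ 2 * fderiv ℝ (fderiv ℝ f) (x + r • (ω : E)) (J ω) (J ω) +
      r * fderiv ℝ f (x + r • (ω : E)) (J (J ω))) ∂(volume : Measure E).toSphere = 0 := by
  have hf1 : ContDiff ℝ 1 (fderiv ℝ f) := hf.fderiv_right (by norm_num)
  have hc1 : Continuous (fderiv ℝ f) := hf1.continuous
  have hc2 : Continuous (fderiv ℝ (fderiv ℝ f)) := (hf1.fderiv_right (m := 0) (by norm_num)).continuous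
  set γ : ℝ → E → E := fun t ω => x + r • (ω + Real.sin t • J ω + (1 - Real.cos t) • J (J ω)) with hγ
  set γ' : ℝ → E → E := fun t ω => r • (Real.cos t • J ω + Real.sin t • J (J ω)) with hγ'
  set γ'' : ℝ → E → E := fun t ω => r • (-Real.sin t • J ω + Real.cos t • J (J ω)) with hγ''
  have cγ : Continuous fun z : ℝ × E => γ z.1 z.2 := by simp only [hγ]; fun_prop
  have cγ' : Continuous fun z : ℝ × E => γ' z.1 z.2 := by simp only [hγ']; fun_prop
  have cγ'' : Continuous fun z : ℝ × E => γ'' z.1 z.2 := by simp only [hγ'']; fun_prop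
  have d1 : ∀ t ω, HasDerivAt (fun t => γ t ω) (γ' t ω) t := by
    intro t ω
    have ha := (Real.hasDerivAt_sin t).smul_const (J ω)
    have hb := ((Real.hasDerivAt_cos t).const_sub 1).smul_const (J (J ω))
    have h := (((ha.const_add ω).fun_add hb).const_smul r).const_add x
    rw [neg_neg] at h
    exact h
  have d2 : ∀ t ω, HasDerivAt (fun t => γ' t ω) (γ'' t ω) t := by
    intro t ω
    have ha := (Real.hasDerivAt_cos t).smul_const (J ω)
    have hb := (Real.hasDerivAt_sin t).smul_const (J (J ω))
    exact (ha.fun_add hb).const_smul r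
  have e1 : ∀ t ω, HasDerivAt (fun t => f (γ t ω)) (fderiv ℝ f (γ t ω) (γ' t ω)) t := fun t ω =>
    ((hf.differentiable (by norm_num)) _).hasFDerivAt.comp_hasDerivAt t (d1 t ω)
  have e2 : ∀ t ω, HasDerivAt (fun t => fderiv ℝ f (γ t ω) (γ' t ω))
      (fderiv ℝ (fderiv ℝ f) (γ t ω) (γ' t ω) (γ' t ω) + fderiv ℝ f (γ t ω) (γ'' t ω)) t := by
    intro t ω
    exact (((hf1.differentiable (by norm_num)) _).hasFDerivAt.comp_hasDerivAt t (d1 t ω)).clm_apply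
      (d2 t ω)
  have k1 : Continuous fun z : ℝ × E => fderiv ℝ f (γ z.1 z.2) (γ' z.1 z.2) :=
    (hc1.comp cγ).clm_apply cγ'
  have k2 : Continuous fun z : ℝ × E => fderiv ℝ (fderiv ℝ f) (γ z.1 z.2) (γ' z.1 z.2) (γ' z.1 z.2) +
      fderiv ℝ f (γ z.1 z.2) (γ'' z.1 z.2) :=
    (((hc2.comp cγ).clm_apply cγ').clm_apply cγ').add ((hc1.comp cγ).clm_apply cγ'')
  have hs : Continuous fun z : ℝ × Metric.sphere (0 : E) 1 => (z.1, (z.2 : E)) := by fun_prop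
  have hst : ∀ t : ℝ, Continuous fun ω : Metric.sphere (0 : E) 1 => (t, (ω : E)) := fun t => by
    fun_prop
  have D1 := hasDerivAt_integral_of_continuous (μ := (volume : Measure E).toSphere)
    (F := fun t (ω : Metric.sphere (0 : E) 1) => f (γ t ω))
    (F' := fun t (ω : Metric.sphere (0 : E) 1) => fderiv ℝ f (γ t ω) (γ' t ω))
    (fun t => (hf.continuous.comp cγ).comp (hst t)) (k1.comp hs) (fun t ω => e1 t ω)
  have D2 := hasDerivAt_integral_of_continuous (μ := (volume : Measure E).toSphere)
    (F := fun t (ω : Metric.sphere (0 : E) 1) => fderiv ℝ f (γ t ω) (γ' t ω))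
    (F' := fun t (ω : Metric.sphere (0 : E) 1) =>
      fderiv ℝ (fderiv ℝ f) (γ t ω) (γ' t ω) (γ' t ω) + fderiv ℝ f (γ t ω) (γ'' t ω))
    (fun t => k1.comp (hst t)) (k2.comp hs) (fun t ω => e2 t ω) 0
  -- By rotation invariance the integral does not depend on t; the claim is that its second
  -- derivative at t = 0 vanishes.
  have hconst : (fun t => ∫ ω : Metric.sphere (0 : E) 1, f (γ t ω) ∂(volume : Measure E).toSphere) =
      fun _ => ∫ ω : Metric.sphere (0 : E) 1, f (x + r • (ω : E)) ∂(volume : Measure E).toSphere := by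
    funext t
    obtain ⟨Φ, hΦ⟩ := exists_rotation hJ hJ3 t
    rw [← integral_toSphere_comp_linearIsometryEquiv Φ (fun y => f (x + r • y))]
    simp only [hΦ, hγ]
  have hz : (fun t => ∫ ω : Metric.sphere (0 : E) 1, fderiv ℝ f (γ t ω) (γ' t ω)
      ∂(volume : Measure E).toSphere) = fun _ => 0 := by
    funext t
    have := D1 t
    rw [hconst] at this
    exact this.unique (hasDerivAt_const _ _)
  rw [hz] at D2
  have := D2.unique (hasDerivAt_const _ _)
  rw [← this]
  congr 1
  funext ω
  simp only [hγ, hγ', hγ'', Real.sin_zero, Real.cos_zero, sub_self, zero_smul, one_smul, add_zero,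
    neg_zero, zero_add, map_smul, _root_.smul_apply, smul_eq_mul]
  ring

/-- A `C²` function with nonpositive Laplacian is at least its mean over each sphere. -/
theorem integral_toSphere_le_of_laplacian_nonpos {ι : Type*} [Fintype ι]
    (b : OrthonormalBasis ι ℝ E) (hd : 2 ≤ Fintype.card ι) {f : E → ℝ} (hf : ContDiff ℝ 2 f)
    (hΔ : ∀ y, ∑ i, fderiv ℝ (fderiv ℝ f) y (b i) (b i) ≤ 0) (x : E) {r : ℝ} (hr : 0 ≤ r) :
    ∫ ω : Metric.sphere (0 : E) 1, f (x + r • (ω : E)) ∂(volume : Measure E).toSphere ≤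
      ∫ _ : Metric.sphere (0 : E) 1, f x ∂(volume : Measure E).toSphere := by
  have hf1 : ContDiff ℝ 1 (fderiv ℝ f) := hf.fderiv_right (by norm_num)
  have hc1 : Continuous (fderiv ℝ f) := hf1.continuous
  have hc2 : Continuous (fderiv ℝ (fderiv ℝ f)) := (hf1.fderiv_right (m := 0) (by norm_num)).continuous
  set φ : ℝ → ℝ := fun r => ∫ ω : Metric.sphere (0 : E) 1, f (x + r • (ω : E)) ∂(volume : Measure E).toSphere with hφ
  set ψ : ℝ → ℝ := fun r => ∫ ω : Metric.sphere (0 : E) 1, fderiv ℝ f (x + r • (ω : E)) ω ∂(volume : Measure E).toSphere with hψ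
  set χ : ℝ → ℝ := fun r => ∫ ω : Metric.sphere (0 : E) 1, fderiv ℝ (fderiv ℝ f) (x + r • (ω : E)) ω ω ∂(volume : Measure E).toSphere with hχ
  set Λ : ℝ → ℝ := fun r => ∫ ω : Metric.sphere (0 : E) 1, ∑ i, fderiv ℝ (fderiv ℝ f) (x + r • (ω : E)) (b i) (b i) ∂(volume : Measure E).toSphere
    with hΛ
  have hpt : ∀ t : ℝ, Continuous fun ω : Metric.sphere (0 : E) 1 => x + t • (ω : E) := fun t => by fun_prop
  have hpz : Continuous fun z : ℝ × Metric.sphere (0 : E) 1 => x + z.1 • (z.2 : E) := by fun_prop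
  have hline : ∀ (t : ℝ) (ω : E), HasDerivAt (fun t : ℝ => x + t • ω) ω t := fun t ω => by
    have h : HasDerivAt (fun t : ℝ => x + t • ω) ((1 : ℝ) • ω) t :=
      ((hasDerivAt_id t).smul_const ω).const_add x
    rwa [one_smul] at h
  have dφ : ∀ t, HasDerivAt φ (ψ t) t := fun t =>
    hasDerivAt_integral_of_continuous (F := fun t (ω : Metric.sphere (0 : E) 1) => f (x + t • (ω : E)))
      (F' := fun t (ω : Metric.sphere (0 : E) 1) => fderiv ℝ f (x + t • (ω : E)) ω)
      (fun t => hf.continuous.comp (hpt t))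
      ((hc1.comp hpz).clm_apply (by fun_prop))
      (fun t ω => ((hf.differentiable (by norm_num)) _).hasFDerivAt.comp_hasDerivAt t (hline t ω)) t
  have dψ : ∀ t, HasDerivAt ψ (χ t) t := fun t =>
    hasDerivAt_integral_of_continuous (F := fun t (ω : Metric.sphere (0 : E) 1) => fderiv ℝ f (x + t • (ω : E)) ω)
      (F' := fun t (ω : Metric.sphere (0 : E) 1) => fderiv ℝ (fderiv ℝ f) (x + t • (ω : E)) ω ω)
      (fun t => (hc1.comp (hpt t)).clm_apply (by fun_prop))
      (((hc2.comp hpz).clm_apply (by fun_prop)).clm_apply (by fun_prop))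
      (fun t ω => by
        have h := (((hf1.differentiable (by norm_num)) _).hasFDerivAt.comp_hasDerivAt t
          (hline t ω)).clm_apply (hasDerivAt_const t (ω : E))
        simpa using h) t
  have hint1 : ∀ t, Integrable (fun ω : Metric.sphere (0 : E) 1 => fderiv ℝ f (x + t • (ω : E)) ω) (volume : Measure E).toSphere := fun t =>
    integrable_toSphere ((hc1.comp (hpt t)).clm_apply continuous_subtype_val)
  have hint2 : ∀ t, Integrable (fun ω : Metric.sphere (0 : E) 1 => fderiv ℝ (fderiv ℝ f) (x + t • (ω : E)) ω ω) (volume : Measure E).toSphere :=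
    fun t => integrable_toSphere
      (((hc2.comp (hpt t)).clm_apply continuous_subtype_val).clm_apply continuous_subtype_val)
  have hint3 : ∀ t, Integrable
      (fun ω : Metric.sphere (0 : E) 1 => ∑ i, fderiv ℝ (fderiv ℝ f) (x + t • (ω : E)) (b i) (b i)) (volume : Measure E).toSphere := fun t =>
    integrable_toSphere (continuous_finsetSum _ fun i _ =>
      ((hc2.comp (hpt t)).clm_apply continuous_const).clm_apply continuous_const)
  -- The polar form of the Laplacian, Δ = ∂_r² + (d - 1)/r ∂_r + spherical part, integrated over the
  -- sphere: summing the rotation identities over all planes eliminates the spherical part.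
  have key : ∀ t, t ^ 2 * (Λ t - χ t) = ((Fintype.card ι : ℝ) - 1) * (t * ψ t) := by
    intro t
    have h0 : ∀ i j, ∫ ω : Metric.sphere (0 : E) 1, (t ^ 2 * fderiv ℝ (fderiv ℝ f) (x + t • (ω : E))
        (planeSkew (b i) (b j) ω) (planeSkew (b i) (b j) ω) +
        t * fderiv ℝ f (x + t • (ω : E)) (planeSkew (b i) (b j) (planeSkew (b i) (b j) ω))) ∂(volume : Measure E).toSphere = 0 :=
      fun i j => integral_toSphere_skew_eq_zero hf (inner_planeSkew _ _) (planeSkew_cube b i j) x t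
    have hI : ∀ i j, Integrable (fun ω : Metric.sphere (0 : E) 1 => t ^ 2 * fderiv ℝ (fderiv ℝ f) (x + t • (ω : E))
        (planeSkew (b i) (b j) ω) (planeSkew (b i) (b j) ω) +
        t * fderiv ℝ f (x + t • (ω : E)) (planeSkew (b i) (b j) (planeSkew (b i) (b j) ω))) (volume : Measure E).toSphere := by
      intro i j
      refine integrable_toSphere (Continuous.add (continuous_const.mul ?_) (continuous_const.mul ?_))
      · exact ((hc2.comp (hpt t)).clm_apply (by fun_prop)).clm_apply (by fun_prop)
      · exact (hc1.comp (hpt t)).clm_apply (by fun_prop)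
    have h1 : ∑ i, ∑ j, ∫ ω : Metric.sphere (0 : E) 1, (t ^ 2 * fderiv ℝ (fderiv ℝ f) (x + t • (ω : E))
        (planeSkew (b i) (b j) ω) (planeSkew (b i) (b j) ω) +
        t * fderiv ℝ f (x + t • (ω : E)) (planeSkew (b i) (b j) (planeSkew (b i) (b j) ω))) ∂(volume : Measure E).toSphere = 0 :=
      Finset.sum_eq_zero fun i _ => Finset.sum_eq_zero fun j _ => h0 i j
    simp only [← integral_finsetSum _ (fun j _ => hI _ j)] at h1
    rw [← integral_finsetSum _ (fun i _ => integrable_finsetSum _ fun j _ => hI i j)] at h1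
    have h2 : ∀ ω : Metric.sphere (0 : E) 1, ∑ i, ∑ j, (t ^ 2 * fderiv ℝ (fderiv ℝ f) (x + t • (ω : E))
        (planeSkew (b i) (b j) ω) (planeSkew (b i) (b j) ω) +
        t * fderiv ℝ f (x + t • (ω : E)) (planeSkew (b i) (b j) (planeSkew (b i) (b j) ω))) =
        2 * t ^ 2 * (∑ i, fderiv ℝ (fderiv ℝ f) (x + t • (ω : E)) (b i) (b i)) -
        2 * t ^ 2 * fderiv ℝ (fderiv ℝ f) (x + t • (ω : E)) ω ω -
        2 * t * ((Fintype.card ι : ℝ) - 1) * fderiv ℝ f (x + t • (ω : E)) ω := by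
      intro ω
      have hω : ‖(ω : E)‖ = 1 := by simp
      simp only [Finset.sum_add_distrib, ← Finset.mul_sum, sum_bilinear_planeSkew, ← map_sum,
        sum_planeSkew_planeSkew, map_smul, smul_eq_mul, hω]
      ring
    simp only [h2] at h1
    have h3 : Integrable (fun ω : Metric.sphere (0 : E) 1 =>
        2 * t ^ 2 * (∑ i, fderiv ℝ (fderiv ℝ f) (x + t • (ω : E)) (b i) (b i)) -
        2 * t ^ 2 * fderiv ℝ (fderiv ℝ f) (x + t • (ω : E)) ω ω) (volume : Measure E).toSphere :=
      ((hint3 t).const_mul _).sub ((hint2 t).const_mul _)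
    rw [integral_sub h3 ((hint1 t).const_mul _),
      integral_sub ((hint3 t).const_mul _) ((hint2 t).const_mul _), integral_const_mul,
      integral_const_mul, integral_const_mul] at h1
    simp only [hΛ, hχ, hψ]
    linarith
  have hΛ0 : ∀ t, Λ t ≤ 0 := fun t => integral_nonpos fun ω => hΔ _
  -- `t ^ (d - 1) * ψ t` is antitone and vanishes at `0`
  obtain ⟨k, hk⟩ := Nat.exists_eq_add_of_le hd
  -- Here d = k + 2; since d ≥ 2 the exponent k + 1 = d - 1 is positive and the product vanishes at
  -- 0.
  have dP : ∀ t, HasDerivAt (fun t => t ^ (k + 1) * ψ t)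
      (((k + 1 : ℕ) : ℝ) * t ^ k * ψ t + t ^ (k + 1) * χ t) t := fun t =>
    (hasDerivAt_pow (k + 1) t).fun_mul (dψ t)
  have hP : AntitoneOn (fun t => t ^ (k + 1) * ψ t) (Set.Ici 0) := by
    refine antitoneOn_of_deriv_nonpos (convex_Ici 0)
      (fun t _ => (dP t).continuousAt.continuousWithinAt)
      (fun t _ => (dP t).differentiableAt.differentiableWithinAt) ?_
    rw [interior_Ici]
    intro t ht
    rw [Set.mem_Ioi] at ht
    rw [(dP t).deriv]
    have h1 : t * (Λ t - χ t) = ((k + 1 : ℕ) : ℝ) * ψ t := by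
      apply mul_left_cancel₀ ht.ne'
      have := key t
      rw [hk] at this
      push_cast at this ⊢
      linear_combination this
    have h2 : ((k + 1 : ℕ) : ℝ) * t ^ k * ψ t + t ^ (k + 1) * χ t = t ^ (k + 1) * Λ t := by
      rw [pow_succ]
      linear_combination (-(t ^ k)) * h1
    rw [h2]
    exact mul_nonpos_of_nonneg_of_nonpos (pow_nonneg ht.le _) (hΛ0 t)
  have hψ0 : ∀ t, 0 < t → ψ t ≤ 0 := by
    intro t ht
    have := hP Set.self_mem_Ici (Set.mem_Ici.mpr ht.le) ht.le
    simp only [ne_eq, Nat.add_eq_zero_iff, one_ne_zero, and_false, not_false_eq_true, zero_pow,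
      zero_mul] at this
    by_contra! hc
    exact absurd this (not_le.mpr (mul_pos (pow_pos ht _) hc))
  have hanti : AntitoneOn φ (Set.Ici 0) := by
    refine antitoneOn_of_deriv_nonpos (convex_Ici 0)
      (fun t _ => (dφ t).continuousAt.continuousWithinAt)
      (fun t _ => (dφ t).differentiableAt.differentiableWithinAt) ?_
    rw [interior_Ici]
    intro t ht
    rw [(dφ t).deriv]
    exact hψ0 t ht
  have := hanti Set.self_mem_Ici (Set.mem_Ici.mpr hr) hr
  simpa only [hφ, zero_smul, add_zero] using this
end

lemma sphereMean_ofReal_le {E : Type*} [NormedAddCommGroup E] [InnerProductSpace ℝ E]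
    [FiniteDimensional ℝ E] [MeasurableSpace E] [BorelSpace E] {f : E → ℝ} (hf : Continuous f)
    (hf0 : ∀ y, 0 ≤ f y) {x : E} {r : ℝ}
    (h : ∫ ω : Metric.sphere (0 : E) 1, f (x + r • (ω : E)) ∂(volume : Measure E).toSphere ≤
      ∫ _ : Metric.sphere (0 : E) 1, f x ∂(volume : Measure E).toSphere) :
    sphereMean (fun y => ENNReal.ofReal (f y)) x r ≤ ENNReal.ofReal (f x) := by
  rw [sphereMean, laverage_eq]
  refine ENNReal.div_le_of_le_mul ?_
  have hc : Continuous fun ω : Metric.sphere (0 : E) 1 => f (x + r • (ω : E)) :=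
    hf.comp (by fun_prop)
  rw [← ofReal_integral_eq_lintegral_ofReal (integrable_toSphere hc)
    (Filter.Eventually.of_forall fun ω => hf0 _), ← lintegral_const,
    ← ofReal_integral_eq_lintegral_ofReal (integrable_const _)
    (Filter.Eventually.of_forall fun ω => hf0 _)]
  exact ENNReal.ofReal_le_ofReal h

/-! ### Removing the regularisation -/

section
variable {n m : ℕ} {p α : ℝ}

lemma spectralPowerSum_nonneg {ε q : ℝ} (hε : 0 ≤ ε) (A : Matrix (Fin n) (Fin m) ℝ) :
    0 ≤ spectralPowerSum ε q A :=
  Finset.sum_nonneg fun i _ => by positivity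

lemma schattenNorm_eq (A : Matrix (Fin n) (Fin m) ℝ) :
    schattenNorm p A = spectralPowerSum 0 (p / 2) A ^ (1 / p) := by
  rw [schattenNorm, spectralPowerSum]
  congr 1
  refine Finset.sum_congr rfl fun i _ => ?_
  have h0 : 0 ≤ matrixSingularValue A i := LinearMap.singularValues_nonneg _ _
  rw [add_zero, ← Real.rpow_natCast, ← Real.rpow_mul h0]
  congr 1
  push_cast
  ring

lemma schattenPrior_eq (hp : 0 < p) (M : MatrixSpace n m) :
    schattenPrior p α M =
      ENNReal.ofReal (spectralPowerSum 0 (p / 2) M.toMatrix) ^ (-(α / p)) := by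
  rw [schattenPrior, schattenNorm_eq, ← ENNReal.ofReal_rpow_of_nonneg
    (spectralPowerSum_nonneg le_rfl _) (by positivity), ← ENNReal.rpow_mul]
  congr 1
  ring

/-- This includes zero power sums: for α > 0 both sides are 0 there, as `∞.toReal` and as a negative
real power of 0. -/
lemma toReal_schattenPrior (hp : 0 < p) (M : MatrixSpace n m) :
    (schattenPrior p α M).toReal = regularizedPrior 0 p α M := by
  rw [schattenPrior_eq hp, ← ENNReal.toReal_rpow,
    ENNReal.toReal_ofReal (spectralPowerSum_nonneg le_rfl _), regularizedPrior]

lemma schattenPrior_ne_top (hp : 0 < p) {M : MatrixSpace n m}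
    (hM : 0 < spectralPowerSum 0 (p / 2) M.toMatrix) : schattenPrior p α M ≠ ∞ := by
  rw [schattenPrior_eq hp, ENNReal.ofReal_rpow_of_pos hM]
  exact ENNReal.ofReal_ne_top

lemma spectralPowerSum_pos (hm : 0 < m) {ε q : ℝ} {A : Matrix (Fin n) (Fin m) ℝ}
    (hA : ∀ i, 0 < matrixSingularValue A i ^ 2 + ε) : 0 < spectralPowerSum ε q A := by
  have : Nonempty (Fin m) := ⟨⟨0, hm⟩⟩
  exact Finset.sum_pos (fun i _ => Real.rpow_pos_of_pos (hA i) _) Finset.univ_nonempty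

lemma ofReal_regularizedPrior (hm : 0 < m) {ε : ℝ} (hε : 0 < ε) (M : MatrixSpace n m) :
    ENNReal.ofReal (regularizedPrior ε p α M) =
      ENNReal.ofReal (spectralPowerSum ε (p / 2) M.toMatrix) ^ (-(α / p)) := by
  rw [regularizedPrior, ENNReal.ofReal_rpow_of_pos (spectralPowerSum_pos hm fun i => by positivity)]

lemma ofReal_regularizedPrior_anti (hm : 0 < m) (hp : 0 < p) (hα : 0 ≤ α) {ε δ : ℝ} (hε : 0 < ε)
    (hεδ : ε ≤ δ) (M : MatrixSpace n m) :
    ENNReal.ofReal (regularizedPrior δ p α M) ≤ ENNReal.ofReal (regularizedPrior ε p α M) := by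
  have hle : spectralPowerSum ε (p / 2) M.toMatrix ≤ spectralPowerSum δ (p / 2) M.toMatrix :=
    Finset.sum_le_sum fun i _ => Real.rpow_le_rpow (by positivity) (by linarith) (by positivity)
  refine ENNReal.ofReal_le_ofReal (Real.rpow_le_rpow_of_nonpos
    (spectralPowerSum_pos hm fun i => by positivity) hle ?_)
  exact neg_nonpos.mpr (by positivity)

/-- The Schatten prior is the increasing limit of its regularisations. -/
lemma schattenPrior_eq_iSup (hm : 0 < m) (hp : 0 < p) (hα : 0 ≤ α) (M : MatrixSpace n m) :
    schattenPrior p α M =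
      ⨆ k : ℕ, ENNReal.ofReal (regularizedPrior (1 / ((k : ℝ) + 1)) p α M) := by
  have hpos : ∀ k : ℕ, 0 < 1 / ((k : ℝ) + 1) := fun k => by positivity
  have hmono : Monotone fun k : ℕ =>
      ENNReal.ofReal (regularizedPrior (1 / ((k : ℝ) + 1)) p α M) := by
    intro k l hkl
    refine ofReal_regularizedPrior_anti hm hp hα (hpos l) ?_ M
    exact one_div_le_one_div_of_le (by positivity) (by gcongr)
  refine tendsto_nhds_unique ?_ (tendsto_atTop_iSup hmono)
  simp only [ofReal_regularizedPrior hm (hpos _)]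
  rw [schattenPrior_eq hp]
  have hc : Continuous fun ε : ℝ => spectralPowerSum ε (p / 2) M.toMatrix := by
    unfold spectralPowerSum
    exact continuous_finsetSum _ fun i _ =>
      (continuous_const.add continuous_id).rpow_const fun _ => Or.inr (by positivity)
  -- Powers are continuous on [0, ∞], so the limit ∞ at the zero matrix needs no separate case.
  exact (ENNReal.continuous_rpow_const.tendsto _).comp ((ENNReal.continuous_ofReal.tendsto _).comp
    ((hc.tendsto 0).comp tendsto_one_div_add_atTop_nhds_zero_nat))

lemma matrixSingularValue_pos_of_rank_eq {A : Matrix (Fin n) (Fin m) ℝ} (hA : A.rank = m)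
    (i : Fin m) : 0 < matrixSingularValue A i := by
  rw [matrixSingularValue, LinearMap.singularValues_pos_iff_lt_finrank_range,
    Matrix.toEuclideanLin_eq_toLin_orthonormal, ← Matrix.rank_eq_finrank_range_toLin, hA]
  exact i.2

/-- A supremum of continuous functions is lower semicontinuous, and monotone convergence carries the
mean value inequality to the increasing limit. -/
lemma isSuperharmonic_schattenPrior (hmn : m ≤ n) (hα : 0 ≤ α)
    (h : (1 ≤ p ∧ p ≤ 2 ∧
            α ≤ (n : ℝ) * (m : ℝ) - (1 - p / 2) * (m : ℝ) * ((m : ℝ) + 1) - p) ∨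
         (0 < p ∧ p < 1 ∧
            α ≤ (n : ℝ) * (m : ℝ) - (m : ℝ) * ((m : ℝ) + 1) + ((m : ℝ) - 1) * p))
    (hp : 0 < p) (hm : 0 < m) (hd : 2 ≤ n * m) :
    IsSuperharmonic (fun M : MatrixSpace n m => schattenPrior p α M) := by
  have hsmooth : ∀ ε : ℝ, 0 < ε → ContDiff ℝ 2 (regularizedPrior (n := n) (m := m) ε p α) :=
    fun ε hε => contDiff_iff_contDiffAt.mpr fun M =>
      contDiffAt_regularizedPrior hm fun i => by positivity
  have hpos : ∀ k : ℕ, 0 < 1 / ((k : ℝ) + 1) := fun k => by positivity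
  have hcont : ∀ k : ℕ, Continuous fun M : MatrixSpace n m =>
      ENNReal.ofReal (regularizedPrior (1 / ((k : ℝ) + 1)) p α M) := fun k =>
    ENNReal.continuous_ofReal.comp (hsmooth _ (hpos k)).continuous
  have hsup : (fun M : MatrixSpace n m => schattenPrior p α M) = fun M =>
      ⨆ k : ℕ, ENNReal.ofReal (regularizedPrior (1 / ((k : ℝ) + 1)) p α M) :=
    funext fun M => schattenPrior_eq_iSup hm hp hα M
  refine ⟨?_, ?_, fun x r hr => ?_⟩
  · obtain ⟨M, hM⟩ := MatrixSpace.exists_toMatrix_eq (rectDiagonal n (fun _ : Fin m => (1 : ℝ)))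
    refine ⟨M, schattenPrior_ne_top hp ?_⟩
    rw [hM, spectralPowerSum_rectDiagonal hmn]
    simpa using hm
  · rw [hsup]
    exact lowerSemicontinuous_iSup fun k => (hcont k).lowerSemicontinuous
  · rw [hsup, sphereMean, laverage_eq, lintegral_iSup, ENNReal.iSup_div]
    · rw [schattenPrior_eq_iSup hm hp hα]
      refine iSup_mono fun k => ?_
      rw [← laverage_eq]
      refine sphereMean_ofReal_le (hsmooth _ (hpos k)).continuous
        (fun M => Real.rpow_nonneg (spectralPowerSum_nonneg (hpos k).le _) _) ?_
      refine integral_toSphere_le_of_laplacian_nonpos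
        (EuclideanSpace.basisFun (Fin n × Fin m) ℝ) (by simpa using hd) (hsmooth _ (hpos k))
        (fun M => ?_) x hr.le
      have := matrixLaplacian_regularizedPrior_nonpos hmn (hpos k).le hα h
        (hsmooth _ (hpos k)).contDiffAt (M := M)
      simpa [matrixLaplacian, iteratedFDeriv_two_apply, Fintype.sum_prod_type] using this
    · exact fun k => (hcont k).measurable.comp (by fun_prop)
    · intro k l hkl ω
      exact ofReal_regularizedPrior_anti hm hp hα (hpos l)
        (one_div_le_one_div_of_le (by positivity) (by gcongr)) _
end

theorem theorem3 (n m : ℕ) (hmn : m ≤ n) (p α : ℝ) (hα : 0 ≤ α)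
    (h : (1 ≤ p ∧ p ≤ 2 ∧
            α ≤ (n : ℝ) * (m : ℝ) - (1 - p / 2) * (m : ℝ) * ((m : ℝ) + 1) - p) ∨
         (0 < p ∧ p < 1 ∧
            α ≤ (n : ℝ) * (m : ℝ) - (m : ℝ) * ((m : ℝ) + 1) + ((m : ℝ) - 1) * p)) :
    -- superharmonic on the whole matrix space
    IsSuperharmonic (fun M : MatrixSpace n m => schattenPrior p α M) ∧
    -- twice continuously differentiable at the matrices of full rank
    (∀ M : MatrixSpace n m, M.toMatrix.rank = m →
      schattenPrior p α M ≠ ∞ ∧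
      ContDiffAt ℝ 2 (fun N : MatrixSpace n m => (schattenPrior p α N).toReal) M) ∧
    -- nonpositive Laplacian wherever the prior is twice continuously differentiable
    (∀ M : MatrixSpace n m,
      ContDiffAt ℝ 2 (fun N : MatrixSpace n m => (schattenPrior p α N).toReal) M →
      matrixLaplacian (fun N : MatrixSpace n m => (schattenPrior p α N).toReal) M ≤ 0) := by
  have hp : 0 < p := by rcases h with h | h <;> linarith [h.1]
  -- For m = 0 both bounds read α ≤ -p, contradicting α ≥ 0.
  have hm : 0 < m := by
    by_contra! hm
    obtain rfl : m = 0 := by omega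
    rcases h with h | h <;> · have := h.2.2; simp at this; linarith
  -- For n = m = 1 both bounds read α ≤ -1, so the dimension is at least 2, as the mean value
  -- inequality requires.
  have hd : 2 ≤ n * m := by
    by_contra! hd
    have hn : 0 < n := hm.trans_le hmn
    have hnm : n * m = 1 := by
      have := Nat.mul_pos hn hm
      omega
    obtain ⟨rfl, rfl⟩ : n = 1 ∧ m = 1 := by simpa using hnm
    rcases h with h | h <;> · have := h.2.2; norm_num at this; linarith
  have hfun : (fun N : MatrixSpace n m => (schattenPrior p α N).toReal) = regularizedPrior 0 p α :=
    funext fun N => toReal_schattenPrior hp N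
  rw [hfun]
  refine ⟨isSuperharmonic_schattenPrior hmn hα h hp hm hd, fun M hM => ?_, fun M hM =>
    matrixLaplacian_regularizedPrior_nonpos hmn le_rfl hα h hM⟩
  have hsv : ∀ i, 0 < matrixSingularValue M.toMatrix i ^ 2 + 0 := fun i => by
    have := matrixSingularValue_pos_of_rank_eq hM i
    positivity
  exact ⟨schattenPrior_ne_top hp (spectralPowerSum_pos hm hsv), contDiffAt_regularizedPrior hm hsv⟩
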